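/- **Setting.** A special group is a triple $(G,-1,\equiv)$, where $G$ is a group of exponent $2$ with a distinguished element $-1$ and $\equiv$ is a relation on $G^2$ satisfying the Dickmann–Miraglia axioms SG0–SG6; write $-g=(-1)g$. Isometry of forms $\langle a_1,\dots,a_n\rangle$ over $G$ is the inductive extension of $\equiv$ to $G^n$, and $D_G(\varphi)$ is the set of $b\in G$ such that $\varphi\equiv\langle b,b_2,\dots,b_n\rangle$ for some $b_i$. Morphisms of special groups are group homomorphisms preserving $-1$ and $\equiv$. An inductive graded ring is a sequence of pointed $\mathbb F_2$-vector spaces $(R_n,\top_n)_{n\ge 0}$ with $R_0\cong\mathbb F_2$, products $R_n\times R_m\to R_{n+m}$ making $\bigoplus_n R_n$ a commutative ring with unit $\top_0$, and pointed homomorphisms $h_n:R_n\to R_{n+1}$ given for $n\ge1$ by $h_n=\top_1\ast{-}$ and compatible with products. Its morphisms are sequences of pointed homomorphisms inducing a ring homomorphism. Two functors from special groups to inductive graded rings are considered. * $k$, the reduced K-theory: $k_*(G)$ is the tensor algebra over $\mathbb Z$ of $G$ written additively (the element of degree $1$ given by $a\in G$ is denoted $l(a)$, so $l(ab)=l(a)+l(b)$),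 modulo $2$ and modulo all $l(a)\otimes l(b)$ with $b\in D_G(\langle 1,-a\rangle)$; the distinguished element of $k_n(G)$ is $l(-1)^n$. * $\mathrm{Grad}\circ W$: $G\mapsto (I^n(G)/I^{n+1}(G))_{n\ge0}$, where $W(G)$ is the Witt ring of $G$ and $I(G)$ is its ideal of classes of even-dimensional forms; the distinguished element is $2^n+I^{n+1}(G)$. A special group is reduced if $-1\notin\bigcup_{n\ge1} D_G(n\langle 1\rangle)$ and, for all $a\in G$, $a\in D_G(\langle1,1\rangle)$ if and only if $a=1$. A reduced special group $G$ is [SMC] if multiplication by $l(-1)$ is an injection $k_n(G)\to k_{n+1}(G)$ for all $n\ge 1$. **Proposition.** There are a natural transformation $s:k\to\mathrm{Grad}\circ W$ of functors from special groups to inductive graded rings and, for each $n\ge 1$, group homomorphisms $r_n(G):I^n(G)/I^{n+1}(G)\to k_{2^{n-1}}(G)$, natural in the special group $G$, such that: 1. for every special group $G$, all $n\ge1$ and $g_1,\dots,g_n\in G$, $$s_n(G)\bigl(l(g_1)\otimes\cdots\otimes l(g_n)\bigr)=\langle 1,-g_1\rangle\otimes\cdots\otimes\langle 1,-g_n\rangle+I^{n+1}(G),$$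 and $s_n(G)$ is surjective for every $n\ge0$; 2. for every special group $G$, all $n\ge1$ and $g_1,\dots,g_n\in G$, $$r_n(G)\bigl(\langle 1,-g_1\rangle\otimes\cdots\otimes\langle 1,-g_n\rangle+I^{n+1}(G)\bigr)=l(-1)^{2^{n-1}-n}\,l(g_1)\otimes\cdots\otimes l(g_n);$$ 3. for every special group $G$ and all $n\ge1$, $r_n(G)\circ s_n(G)$ is multiplication by $l(-1)^{2^{n-1}-n}$; 4. for every special group $G$, $s_1(G):k_1(G)\to I(G)/I^2(G)$ and $s_2(G):k_2(G)\to I^2(G)/I^3(G)$ are isomorphisms of pointed $\mathbb F_2$-vector spaces; 5. if a reduced special group $G$ is [SMC], then $s_G:k(G)\to\mathrm{Grad}(W(G))$ is an isomorphism of inductive graded rings. -/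

import Mathlib

universe u

/-! ### Special groups -/

/-- The extension of a binary relation on `A × A` to a binary relation on `A × A × A`. -/
def Ext3 {A : Type u} (E : A → A → A → A → Prop) (a₁ a₂ a₃ b₁ b₂ b₃ : A) : Prop :=
  ∃ x y z, E a₁ x b₁ y ∧ E a₂ a₃ x z ∧ E b₂ b₃ y z

/-- A special group `(G, -1, ≡)`; `Eqv a b c d` is the special relation `⟨a,b⟩ ≡ ⟨c,d⟩`. -/
class SpecialGroup (G : Type u) extends CommGroup G where
  negOne : G
  Eqv : G → G → G → G → Prop
  mul_self_eq : ∀ g : G, g * g = 1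
  sg0_refl : ∀ a b, Eqv a b a b
  sg0_symm : ∀ a b c d, Eqv a b c d → Eqv c d a b
  sg0_trans : ∀ a b c d e f, Eqv a b c d → Eqv c d e f → Eqv a b e f
  sg1 : ∀ a b, Eqv a b b a
  sg2 : ∀ a, Eqv a (negOne * a) 1 negOne
  sg3 : ∀ a b c d, Eqv a b c d → a * b = c * d
  sg4 : ∀ a b c d, Eqv a b c d → Eqv a (negOne * c) (negOne * b) d
  sg5 : ∀ a b c d g, Eqv a b c d → Eqv (g * a) (g * b) (g * c) (g * d)
  sg6 : ∀ a₁ a₂ a₃ b₁ b₂ b₃ c₁ c₂ c₃,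
    Ext3 Eqv a₁ a₂ a₃ b₁ b₂ b₃ → Ext3 Eqv b₁ b₂ b₃ c₁ c₂ c₃ → Ext3 Eqv a₁ a₂ a₃ c₁ c₂ c₃

namespace SpecialGroup

variable {G : Type u} [SpecialGroup G]

/-- The element `-a` of a special group. -/
def neg (a : G) : G := negOne * a

/-- Isometry `φ ≡ₙ ψ` of forms; a form `⟨a₁,…,aₙ⟩` is the list of its entries
(the empty list is the form of dimension `0`). -/
inductive Isom : List G → List G → Prop
  | nil : Isom [] []
  | single (a : G) : Isom [a] [a]
  | pair {a b c d : G} : Eqv a b c d → Isom [a, b] [c, d]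
  | cons {a b x y z : G} {as bs zs : List G} : Eqv a x b y →
      Isom as (x :: z :: zs) → Isom bs (y :: z :: zs) → Isom (a :: as) (b :: bs)

/-- `b ∈ D_G(φ)`. -/
def Represents (φ : List G) (b : G) : Prop := ∃ t, Isom (b :: t) φ

variable (G) in
/-- `-1 ∉ ⋃ₙ D_G(n⟨1⟩)`. -/
def IsFormallyReal : Prop := ∀ n : ℕ, 1 ≤ n → ¬ Represents (List.replicate n (1 : G)) negOne

variable (G) in
def IsReduced : Prop :=
  IsFormallyReal G ∧ ∀ a : G, Represents [1, 1] a ↔ a = 1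

/-! Isometry coincides with the equivalence relation generated by binary isometries; this is used
only to see that the Witt ring is well defined. -/

inductive Step : List G → List G → Prop
  | head {a b c d : G} (l : List G) : Eqv a b c d → Step (a :: b :: l) (c :: d :: l)
  | tail (a : G) {l l' : List G} : Step l l' → Step (a :: l) (a :: l')

def Chain : List G → List G → Prop := Relation.ReflTransGen Step

theorem Step.symm {φ ψ : List G} (h : Step φ ψ) : Step ψ φ := by
  induction h with
  | head l h => exact .head l (sg0_symm _ _ _ _ h)
  | tail a _ ih => exact .tail a ih

theorem Chain.refl (φ : List G) : Chain φ φ := Relation.ReflTransGen.refl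

theorem Chain.trans {φ ψ χ : List G} (h : Chain φ ψ) (h' : Chain ψ χ) : Chain φ χ :=
  Relation.ReflTransGen.trans h h'

theorem Chain.symm {φ ψ : List G} (h : Chain φ ψ) : Chain ψ φ := by
  induction h with
  | refl => exact .refl _
  | tail _ s ih => exact (Relation.ReflTransGen.single s.symm).trans ih

theorem Chain.head {a b c d : G} (l : List G) (h : Eqv a b c d) :
    Chain (a :: b :: l) (c :: d :: l) := Relation.ReflTransGen.single (.head l h)

theorem Chain.cons (a : G) {φ ψ : List G} (h : Chain φ ψ) : Chain (a :: φ) (a :: ψ) := by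
  induction h with
  | refl => exact .refl _
  | tail _ s ih => exact Relation.ReflTransGen.tail ih (.tail a s)

theorem Step.length_eq {φ ψ : List G} (h : Step φ ψ) : φ.length = ψ.length := by
  induction h with
  | head l h => simp
  | tail a _ ih => simp [ih]

theorem Chain.length_eq {φ ψ : List G} (h : Chain φ ψ) : φ.length = ψ.length := by
  induction h with
  | refl => rfl
  | tail _ s ih => exact ih.trans s.length_eq

theorem Chain.nil_left {φ : List G} (h : Chain [] φ) : φ = [] :=
  List.length_eq_zero_iff.1 h.length_eq.symm

theorem Chain.single_left {a : G} {φ : List G} (h : Chain [a] φ) : φ = [a] := by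
  induction h with
  | refl => rfl
  | tail _ s ih => subst ih; cases s with | tail _ s => cases s

theorem Chain.pair {a b : G} {φ : List G} (h : Chain [a, b] φ) :
    ∃ c d, φ = [c, d] ∧ Eqv a b c d := by
  induction h with
  | refl => exact ⟨a, b, rfl, sg0_refl a b⟩
  | tail _ s ih =>
    obtain ⟨c, d, rfl, e⟩ := ih
    cases s with
    | head _ h => exact ⟨_, _, rfl, sg0_trans _ _ _ _ _ _ e h⟩
    | tail _ s => cases s with | tail _ s => cases s

theorem ext3_12 {a b c d : G} (e : G) (h : Eqv a b c d) : Ext3 Eqv a b e c d e :=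
  ⟨b, d, e, h, sg0_refl _ _, sg0_refl _ _⟩

theorem ext3_23 {a b c d : G} (e : G) (h : Eqv a b c d) : Ext3 Eqv e a b e c d :=
  ⟨a, a, b, sg0_refl _ _, sg0_refl _ _, sg0_symm _ _ _ _ h⟩

/-- The key step: the first entries of chain-equivalent forms can be compared. -/
theorem Chain.key : ∀ (n : ℕ) (a b : G) (as bs : List G), as.length = n + 1 →
    Chain (a :: as) (b :: bs) →
    ∃ x y zs, Eqv a x b y ∧ Chain as (x :: zs) ∧ Chain bs (y :: zs) := by
  intro n
  induction n with
  | zero =>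
    intro a b as bs hl h
    obtain ⟨a₂, rfl⟩ := List.length_eq_one_iff.1 hl
    obtain ⟨c, d, e, h'⟩ := h.pair
    simp only [List.cons.injEq] at e
    obtain ⟨rfl, rfl⟩ := e
    exact ⟨a₂, d, [], h', .refl _, .refl _⟩
  | succ n ihn =>
    intro a b as bs hl h
    generalize hψ : b :: bs = ψ at h
    induction h generalizing b bs with
    | refl =>
      simp only [List.cons.injEq] at hψ
      obtain ⟨rfl, rfl⟩ := hψ
      cases bs with
      | nil => simp at hl
      | cons x zs => exact ⟨x, x, zs, sg0_refl _ _, .refl _, .refl _⟩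
    | @tail χ ψ hc s ih =>
      subst hψ
      cases s with
      | @head b₁ b₂ _ c₂ l e =>
        obtain ⟨x, y, zs, h₁, h₂, h₃⟩ := ih b₁ (b₂ :: l) rfl
        have hlen : l.length = n + 1 := by
          have := Chain.length_eq hc
          simp only [List.length_cons] at this
          omega
        obtain ⟨p, q, w, k₁, k₂, k₃⟩ := ihn b₂ y l zs hlen h₃
        have t₁ := ext3_12 q h₁
        have t₂ := ext3_23 b₁ (sg0_trans _ _ _ _ _ _ (sg0_symm _ _ _ _ k₁) (sg0_refl _ _))
        have t₃ := ext3_12 p e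
        obtain ⟨x', y', z', m₁, m₂, m₃⟩ :=
          sg6 _ _ _ _ _ _ _ _ _ (sg6 _ _ _ _ _ _ _ _ _ t₁ t₂) t₃
        refine ⟨x', y', z' :: w, m₁, ?_, ?_⟩
        · exact (h₂.trans (k₃.cons x)).trans (.head w m₂)
        · exact (k₂.cons c₂).trans (.head w m₃)
      | tail _ s =>
        obtain ⟨x, y, zs, h₁, h₂, h₃⟩ := ih b _ rfl
        exact ⟨x, y, zs, h₁, h₂, (Relation.ReflTransGen.single s.symm).trans h₃⟩

theorem Isom.chain {φ ψ : List G} (h : Isom φ ψ) : Chain φ ψ := by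
  induction h with
  | nil => exact .refl _
  | single a => exact .refl _
  | pair h => exact .head _ h
  | cons h _ _ ih₁ ih₂ => exact ((ih₁.cons _).trans (.head _ h)).trans (ih₂.symm.cons _)

theorem Chain.isom : ∀ (n : ℕ) (φ ψ : List G), φ.length = n → Chain φ ψ → Isom φ ψ := by
  intro n
  induction n with
  | zero =>
    intro φ ψ hl h
    obtain rfl := List.length_eq_zero_iff.1 hl
    rw [h.nil_left]; exact .nil
  | succ n ih =>
    intro φ ψ hl h
    match φ, ψ, hl, h with
    | [], _, hl, _ => simp at hl
    | [a], ψ, _, h => rw [h.single_left]; exact .single a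
    | [a, b], ψ, _, h => obtain ⟨c, d, rfl, e⟩ := h.pair; exact .pair e
    | a :: b :: c :: l, [], _, h => simpa using h.length_eq
    | a :: b :: c :: l, d :: ψ, hl, h =>
      obtain ⟨x, y, zs, h₁, h₂, h₃⟩ := Chain.key (l.length + 1) a d (b :: c :: l) ψ (by simp) h
      have hl' : (b :: c :: l).length = n := by simpa using hl
      have e₁ := h.length_eq
      have e₂ := h₂.length_eq
      match zs, h₂, h₃, e₂ with
      | [], _, _, e₂ => simp at e₂
      | z :: zs, h₂, h₃, _ =>
        refine .cons h₁ (ih _ _ hl' h₂) (ih _ _ ?_ h₃)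
        simp only [List.length_cons] at e₁ hl' ⊢
        omega

theorem isom_iff_chain {φ ψ : List G} : Isom φ ψ ↔ Chain φ ψ :=
  ⟨Isom.chain, Chain.isom _ φ ψ rfl⟩

theorem Chain.append_left (χ : List G) {φ ψ : List G} (h : Chain φ ψ) :
    Chain (χ ++ φ) (χ ++ ψ) := by
  induction χ with
  | nil => exact h
  | cons a χ ih => exact ih.cons a

theorem Chain.append_right {φ ψ : List G} (h : Chain φ ψ) (χ : List G) :
    Chain (φ ++ χ) (ψ ++ χ) := by
  have key : ∀ {φ ψ : List G}, Step φ ψ → Step (φ ++ χ) (ψ ++ χ) := by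
    intro φ ψ h
    induction h with
    | head l h => exact .head _ h
    | tail a _ ih => exact .tail a ih
  induction h with
  | refl => exact .refl _
  | tail _ s ih => exact Relation.ReflTransGen.tail ih (key s)

theorem Chain.of_perm {φ ψ : List G} (h : φ.Perm ψ) : Chain φ ψ := by
  induction h with
  | nil => exact .refl _
  | cons a _ ih => exact ih.cons a
  | swap a b l => exact .head l (sg1 _ _)
  | trans _ _ ih₁ ih₂ => exact ih₁.trans ih₂

/-! ### The Witt ring -/

/-- The product form `φ ⊗ ψ`. -/
def tensor (φ ψ : List G) : List G := φ.flatMap fun a => ψ.map (a * ·)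

variable (G) in
/-- The hyperbolic form `m⟨1,-1⟩`. -/
def hyp : ℕ → List G
  | 0 => []
  | m + 1 => 1 :: negOne :: hyp m

/-- Witt equivalence of forms. -/
def WittEquiv (φ ψ : List G) : Prop := ∃ m n, Isom (φ ++ hyp G m) (ψ ++ hyp G n)

theorem hyp_add (m n : ℕ) : hyp G (m + n) = hyp G m ++ hyp G n := by
  induction m with
  | zero => simp [hyp]
  | succ m ih => rw [Nat.succ_add]; simp [hyp, ih]

theorem wittEquiv_iff {φ ψ : List G} :
    WittEquiv φ ψ ↔ ∃ m n, Chain (φ ++ hyp G m) (ψ ++ hyp G n) := by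
  simp only [WittEquiv, isom_iff_chain]

theorem Chain.witt {φ ψ : List G} (h : Chain φ ψ) : WittEquiv φ ψ :=
  wittEquiv_iff.2 ⟨0, 0, h.append_right _⟩

theorem perm_witt {φ ψ : List G} (h : φ.Perm ψ) : WittEquiv φ ψ :=
  (Chain.of_perm h).witt

theorem wittEquiv_append_hyp (φ : List G) (m : ℕ) : WittEquiv (φ ++ hyp G m) φ :=
  wittEquiv_iff.2 ⟨0, m, by simpa [hyp] using Chain.refl _⟩

theorem WittEquiv.refl (φ : List G) : WittEquiv φ φ := (Chain.refl φ).witt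

theorem WittEquiv.symm {φ ψ : List G} (h : WittEquiv φ ψ) : WittEquiv ψ φ := by
  obtain ⟨m, n, h⟩ := wittEquiv_iff.1 h
  exact wittEquiv_iff.2 ⟨n, m, h.symm⟩

theorem WittEquiv.trans {φ ψ χ : List G} (h : WittEquiv φ ψ) (h' : WittEquiv ψ χ) :
    WittEquiv φ χ := by
  obtain ⟨m, n, h⟩ := wittEquiv_iff.1 h
  obtain ⟨p, q, h'⟩ := wittEquiv_iff.1 h'
  refine wittEquiv_iff.2 ⟨m + p, q + n, ?_⟩
  have h₁ := h.append_right (hyp G p)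
  have h₂ := h'.append_right (hyp G n)
  rw [List.append_assoc, ← hyp_add] at h₁ h₂
  rw [List.append_assoc, ← hyp_add, add_comm n p] at h₁
  rw [List.append_assoc, ← hyp_add] at h₂
  exact h₁.trans h₂

instance wittSetoid (G : Type u) [SpecialGroup G] : Setoid (List G) where
  r := WittEquiv
  iseqv := ⟨WittEquiv.refl, WittEquiv.symm, WittEquiv.trans⟩

theorem WittEquiv.append {φ φ' ψ ψ' : List G} (h : WittEquiv φ φ') (h' : WittEquiv ψ ψ') :
    WittEquiv (φ ++ ψ) (φ' ++ ψ') := by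
  have key : ∀ {φ φ' : List G} (ψ : List G), WittEquiv φ φ' → WittEquiv (φ ++ ψ) (φ' ++ ψ) := by
    intro φ φ' ψ h
    obtain ⟨m, n, h⟩ := wittEquiv_iff.1 h
    refine wittEquiv_iff.2 ⟨m, n, ?_⟩
    have p : ∀ (φ : List G) (m : ℕ), ((φ ++ ψ) ++ hyp G m).Perm ((φ ++ hyp G m) ++ ψ) := by
      intro φ m
      simp only [List.append_assoc]
      exact List.perm_append_comm.append_left φ
    exact ((Chain.of_perm (p φ m)).trans (h.append_right ψ)).trans (Chain.of_perm (p φ' n).symm)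
  exact ((key ψ h).trans (perm_witt List.perm_append_comm)).trans
    ((key φ' h').trans (perm_witt List.perm_append_comm))

theorem tensor_append_left (φ φ' ψ : List G) :
    tensor (φ ++ φ') ψ = tensor φ ψ ++ tensor φ' ψ := by simp [tensor]

theorem tensor_comm_perm (φ ψ : List G) : (tensor φ ψ).Perm (tensor ψ φ) := by
  rw [← Multiset.coe_eq_coe]
  have h : ∀ φ ψ : List G, ((tensor φ ψ : List G) : Multiset G) =
      (φ : Multiset G).bind fun a => (ψ : Multiset G).bind fun b => {a * b} := by
    intro φ ψ
    simp [tensor, Multiset.bind_singleton, ← Multiset.coe_bind]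
  rw [h, h, Multiset.bind_bind]
  simp only [mul_comm]

theorem tensor_assoc (φ ψ χ : List G) : tensor (tensor φ ψ) χ = tensor φ (tensor ψ χ) := by
  simp [tensor, List.flatMap_assoc, List.flatMap_map, List.map_flatMap, Function.comp_def, mul_assoc]

theorem map_mul_append_chain {a b c d : G} (h : Eqv a b c d) (ψ : List G) :
    Chain (ψ.map (a * ·) ++ ψ.map (b * ·)) (ψ.map (c * ·) ++ ψ.map (d * ·)) := by
  induction ψ with
  | nil => exact .refl _
  | cons g ψ ih =>
    simp only [List.map_cons, List.cons_append]
    have p : ∀ (s t : List G) (x y : G), (x :: (s ++ y :: t)).Perm (x :: y :: (s ++ t)) :=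
      fun s t x y => List.perm_middle.cons x
    refine (Chain.of_perm (p _ _ _ _)).trans (.trans ?_ (Chain.of_perm (p _ _ _ _).symm))
    refine Chain.trans (.head _ ?_) ((ih.cons _).cons _)
    have := sg5 _ _ _ _ g h
    simpa only [mul_comm] using this

theorem Chain.tensor {φ φ' : List G} (h : Chain φ φ') (ψ : List G) :
    Chain (tensor φ ψ) (SpecialGroup.tensor φ' ψ) := by
  have key : ∀ {φ φ' : List G}, Step φ φ' →
      Chain (SpecialGroup.tensor φ ψ) (SpecialGroup.tensor φ' ψ) := by
    intro φ φ' h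
    induction h with
    | head l h =>
      have := (map_mul_append_chain h ψ).append_right (SpecialGroup.tensor l ψ)
      simpa [SpecialGroup.tensor] using this
    | tail a _ ih =>
      simpa [SpecialGroup.tensor] using ih.append_left (ψ.map (a * ·))
  induction h with
  | refl => exact .refl _
  | tail _ s ih => exact ih.trans (key s)

theorem append_neg_chain (ψ : List G) : Chain (ψ ++ ψ.map neg) (hyp G ψ.length) := by
  induction ψ with
  | nil => exact .refl _
  | cons g ψ ih =>
    simp only [List.map_cons, List.cons_append, List.length_cons, hyp]
    refine (Chain.of_perm (List.perm_middle.cons g)).trans ?_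
    exact Chain.trans (.head _ (sg2 g)) ((ih.cons _).cons _)

theorem hyp_tensor_chain (m : ℕ) (ψ : List G) :
    Chain (tensor (hyp G m) ψ) (hyp G (m * ψ.length)) := by
  induction m with
  | zero => simpa [hyp, tensor] using Chain.refl _
  | succ m ih =>
    have e : tensor (hyp G (m + 1)) ψ = (ψ ++ ψ.map neg) ++ tensor (hyp G m) ψ := by
      simp [hyp, tensor, neg]
    rw [e, Nat.succ_mul, add_comm, hyp_add]
    exact ((append_neg_chain ψ).append_right _).trans (ih.append_left _)

theorem WittEquiv.tensor {φ φ' ψ ψ' : List G} (h : WittEquiv φ φ') (h' : WittEquiv ψ ψ') :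
    WittEquiv (tensor φ ψ) (SpecialGroup.tensor φ' ψ') := by
  have key : ∀ {φ φ' : List G} (ψ : List G), WittEquiv φ φ' →
      WittEquiv (SpecialGroup.tensor φ ψ) (SpecialGroup.tensor φ' ψ) := by
    intro φ φ' ψ h
    obtain ⟨m, n, h⟩ := wittEquiv_iff.1 h
    refine wittEquiv_iff.2 ⟨m * ψ.length, n * ψ.length, ?_⟩
    have := h.tensor ψ
    rw [tensor_append_left, tensor_append_left] at this
    exact (((hyp_tensor_chain m ψ).symm.append_left _).trans this).trans
      ((hyp_tensor_chain n ψ).append_left _)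
  exact ((key ψ h).trans (perm_witt (tensor_comm_perm _ _))).trans
    ((key φ' h').trans (perm_witt (tensor_comm_perm _ _)))

variable (G) in
/-- The Witt ring `W(G)`: classes of forms modulo Witt equivalence, with `⊕` and `⊗`. -/
def Witt : Type u := Quotient (wittSetoid G)

namespace Witt

/-- The class of a form. -/
def mk (φ : List G) : Witt G := Quotient.mk (wittSetoid G) φ

theorem mk_eq {φ ψ : List G} (h : WittEquiv φ ψ) : mk φ = mk ψ := Quotient.sound h

theorem mk_surj (x : Witt G) : ∃ φ, mk φ = x := Quotient.exists_rep x

instance : Zero (Witt G) := ⟨mk []⟩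
instance : One (Witt G) := ⟨mk [1]⟩
instance : Add (Witt G) := ⟨Quotient.map₂ (· ++ ·) fun _ _ h _ _ h' => WittEquiv.append h h'⟩
instance : Mul (Witt G) := ⟨Quotient.map₂ tensor fun _ _ h _ _ h' => WittEquiv.tensor h h'⟩
instance : Neg (Witt G) := ⟨fun x => mk [negOne] * x⟩

theorem mk_add (φ ψ : List G) : mk φ + mk ψ = mk (φ ++ ψ) := rfl
theorem mk_mul (φ ψ : List G) : mk φ * mk ψ = mk (tensor φ ψ) := rfl
theorem zero_def : (0 : Witt G) = mk [] := rfl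
theorem one_def : (1 : Witt G) = mk [1] := rfl
theorem neg_def (x : Witt G) : -x = mk [negOne] * x := rfl

theorem add_comm' (x y : Witt G) : x + y = y + x := by
  obtain ⟨φ, rfl⟩ := mk_surj x
  obtain ⟨ψ, rfl⟩ := mk_surj y
  exact mk_eq (perm_witt List.perm_append_comm)

theorem mul_comm' (x y : Witt G) : x * y = y * x := by
  obtain ⟨φ, rfl⟩ := mk_surj x
  obtain ⟨ψ, rfl⟩ := mk_surj y
  exact mk_eq (perm_witt (tensor_comm_perm _ _))

theorem right_distrib' (x y z : Witt G) : (x + y) * z = x * z + y * z := by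
  obtain ⟨φ, rfl⟩ := mk_surj x
  obtain ⟨ψ, rfl⟩ := mk_surj y
  obtain ⟨χ, rfl⟩ := mk_surj z
  simp only [mk_add, mk_mul, tensor_append_left]

theorem zero_add' (x : Witt G) : 0 + x = x := by
  obtain ⟨φ, rfl⟩ := mk_surj x
  rfl

theorem one_mul' (x : Witt G) : 1 * x = x := by
  obtain ⟨φ, rfl⟩ := mk_surj x
  simp [one_def, mk_mul, tensor]

theorem zero_mul' (x : Witt G) : 0 * x = 0 := by
  obtain ⟨φ, rfl⟩ := mk_surj x
  rfl

instance : CommRing (Witt G) where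
  add_assoc x y z := by
    obtain ⟨φ, rfl⟩ := mk_surj x
    obtain ⟨ψ, rfl⟩ := mk_surj y
    obtain ⟨χ, rfl⟩ := mk_surj z
    simp only [mk_add, List.append_assoc]
  zero_add := zero_add'
  add_zero x := by rw [add_comm', zero_add']
  add_comm := add_comm'
  left_distrib x y z := by
    rw [mul_comm', right_distrib', mul_comm' y, mul_comm' z]
  right_distrib := right_distrib'
  zero_mul := zero_mul'
  mul_zero x := by rw [mul_comm', zero_mul']
  mul_assoc x y z := by
    obtain ⟨φ, rfl⟩ := mk_surj x
    obtain ⟨ψ, rfl⟩ := mk_surj y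
    obtain ⟨χ, rfl⟩ := mk_surj z
    simp only [mk_mul, tensor_assoc]
  one_mul := one_mul'
  mul_one x := by rw [mul_comm', one_mul']
  mul_comm := mul_comm'
  neg_add_cancel x := by
    obtain ⟨φ, rfl⟩ := mk_surj x
    rw [add_comm', neg_def, mk_mul, mk_add, zero_def]
    have e : φ ++ tensor [negOne] φ = φ ++ φ.map neg := by simp [tensor, neg]
    rw [e]
    exact mk_eq ((append_neg_chain φ).witt.trans (wittEquiv_append_hyp [] _))
  nsmul := nsmulRec
  zsmul := zsmulRec

end Witt

theorem hyp_length (m : ℕ) : (hyp G m).length = 2 * m := by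
  induction m with
  | zero => rfl
  | succ m ih => simp [hyp, ih]; ring

theorem WittEquiv.dim {φ ψ : List G} (h : WittEquiv φ ψ) :
    (φ.length : ZMod 2) = (ψ.length : ZMod 2) := by
  obtain ⟨m, n, h⟩ := wittEquiv_iff.1 h
  have := congrArg (Nat.cast : ℕ → ZMod 2) h.length_eq
  have e : (2 : ZMod 2) = 0 := rfl
  simpa [hyp_length, e] using this

theorem tensor_length (φ ψ : List G) : (tensor φ ψ).length = φ.length * ψ.length := by
  simp [tensor, List.length_flatMap]

variable (G) in
/-- The dimension modulo `2`. -/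
def dim2 : Witt G →+* ZMod 2 where
  toFun := Quotient.lift (fun φ : List G => (φ.length : ZMod 2)) fun _ _ h => WittEquiv.dim h
  map_zero' := by change (([] : List G).length : ZMod 2) = 0; simp
  map_one' := by change (([1] : List G).length : ZMod 2) = 1; simp
  map_add' x y := by
    obtain ⟨φ, rfl⟩ := Witt.mk_surj x
    obtain ⟨ψ, rfl⟩ := Witt.mk_surj y
    change ((φ ++ ψ).length : ZMod 2) = φ.length + ψ.length
    simp
  map_mul' x y := by
    obtain ⟨φ, rfl⟩ := Witt.mk_surj x
    obtain ⟨ψ, rfl⟩ := Witt.mk_surj y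
    change ((tensor φ ψ).length : ZMod 2) = φ.length * ψ.length
    simp [tensor_length]

@[simp] theorem dim2_mk (φ : List G) : dim2 G (Witt.mk φ) = (φ.length : ZMod 2) := rfl

end SpecialGroup

/-! ### Inductive graded rings -/

/-- The composite `h_{n+k-1} ∘ ⋯ ∘ h_n : R_n → R_{n+k}`. -/
def iterH {R : ℕ → Type u} (h : ∀ n, R n → R (n + 1)) (n : ℕ) : ∀ k, R n → R (n + k)
  | 0, x => x
  | k + 1, x => h (n + k) (iterH h n k x)

/-- Inductive graded rings. The graded product is Mathlib's `DirectSum.GCommRing`, which is what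
makes `⨁ n, R n` a commutative ring with homogeneous product. -/
structure Igr : Type (u + 1) where
  R : ℕ → Type u
  [grp : ∀ n, AddCommGroup (R n)]
  [ring : DirectSum.GCommRing R]
  top : ∀ n, R n
  h : ∀ n, R n →+ R (n + 1)
  zero_equiv : Nonempty (R 0 ≃+ ZMod 2)
  add_self_eq : ∀ n (x : R n), x + x = 0
  top_zero : DirectSum.of R 0 (top 0) = 1
  h_top : ∀ n, h n (top n) = top (n + 1)
  h_eq : ∀ n, 1 ≤ n → ∀ x : R n,
    DirectSum.of R 1 (top 1) * DirectSum.of R n x = DirectSum.of R (n + 1) (h n x)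
  h_mul : ∀ n m k l (x : R n) (y : R m),
    DirectSum.of R (n + k) (iterH (fun i => h i) n k x) *
        DirectSum.of R (m + l) (iterH (fun i => h i) m l y) =
      DirectSum.of R (n + m + (k + l))
        (iterH (fun i => h i) (n + m) (k + l) (GradedMonoid.GMul.mul x y))

attribute [instance] Igr.grp Igr.ring

namespace Igr

/-- The commutative ring `⨁ n, R n`. -/
abbrev Total (R : Igr.{u}) : Type u := DirectSum ℕ R.R

/-- The inclusion of the degree `n` component in the ring `⨁ n, R n`. -/
abbrev of (R : Igr.{u}) (n : ℕ) (x : R.R n) : R.Total := DirectSum.of R.R n x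

/-- Morphisms: pointed homomorphisms in each degree whose direct sum is a ring homomorphism. -/
@[ext] structure Hom (R S : Igr.{u}) : Type u where
  app : ∀ n, R.R n →+ S.R n
  map_top : ∀ n, app n (R.top n) = S.top n
  map_mul : ∀ n m (x : R.R n) (y : R.R m),
    app (n + m) (GradedMonoid.GMul.mul x y) = GradedMonoid.GMul.mul (app n x) (app m y)

instance : CategoryTheory.Category.{u} Igr.{u} where
  Hom := Hom
  id R := ⟨fun _ => AddMonoidHom.id _, fun _ => rfl, fun _ _ _ _ => rfl⟩
  comp f g := ⟨fun n => (g.app n).comp (f.app n), fun n => by simp [f.map_top, g.map_top],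
    fun n m x y => by simp [f.map_mul, g.map_mul]⟩

/-- Degree `n` component of a morphism. -/
def map {R S : Igr.{u}} (f : R ⟶ S) (n : ℕ) : R.R n →+ S.R n := Hom.app f n

/-- The functor of degree `n` components. -/
def component (n : ℕ) : CategoryTheory.Functor Igr.{u} AddCommGrpCat.{u} where
  obj R := AddCommGrpCat.of (R.R n)
  map f := AddCommGrpCat.ofHom (Igr.map f n)

theorem iterH_of {R : ℕ → Type u} [∀ n, AddCommGroup (R n)] [DirectSum.GCommRing R]
    (t : R 1) (h : ∀ n, R n →+ R (n + 1))
    (h_eq : ∀ n (x : R n), DirectSum.of R 1 t * DirectSum.of R n x = DirectSum.of R (n + 1) (h n x))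
    (n k : ℕ) (x : R n) :
    DirectSum.of R (n + k) (iterH (fun i => h i) n k x) =
      DirectSum.of R 1 t ^ k * DirectSum.of R n x := by
  induction k with
  | zero => simp [iterH]
  | succ k ih =>
    have := h_eq (n + k) (iterH (fun i => h i) n k x)
    rw [ih] at this
    rw [pow_succ', mul_assoc, this]
    rfl

theorem iterH_mul {R : ℕ → Type u} [∀ n, AddCommGroup (R n)] [DirectSum.GCommRing R]
    (t : R 1) (h : ∀ n, R n →+ R (n + 1))
    (h_eq : ∀ n (x : R n), DirectSum.of R 1 t * DirectSum.of R n x = DirectSum.of R (n + 1) (h n x))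
    (n m k l : ℕ) (x : R n) (y : R m) :
    DirectSum.of R (n + k) (iterH (fun i => h i) n k x) *
        DirectSum.of R (m + l) (iterH (fun i => h i) m l y) =
      DirectSum.of R (n + m + (k + l))
        (iterH (fun i => h i) (n + m) (k + l) (GradedMonoid.GMul.mul x y)) := by
  rw [iterH_of t h h_eq, iterH_of t h h_eq, iterH_of t h h_eq, ← DirectSum.of_mul_of]
  ring

end Igr

/-! ### The graded ring of the powers of an ideal -/

namespace Gr

variable {A : Type u} [CommRing A] (I : Ideal A)

/-- `Iⁿ / Iⁿ⁺¹`. -/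
def Piece (n : ℕ) : Type u := ↥(I ^ n) ⧸ Submodule.comap (I ^ n).subtype (I ^ (n + 1))

instance (n : ℕ) : AddCommGroup (Piece I n) :=
  inferInstanceAs (AddCommGroup (↥(I ^ n) ⧸ Submodule.comap (I ^ n).subtype (I ^ (n + 1))))

/-- The class `a + Iⁿ⁺¹` of `a ∈ Iⁿ`. -/
def mk (n : ℕ) (a : A) (ha : a ∈ I ^ n) : Piece I n :=
  (Submodule.comap (I ^ n).subtype (I ^ (n + 1))).mkQ ⟨a, ha⟩

variable {I}

theorem mk_eq_mk {n : ℕ} {a b : A} {ha : a ∈ I ^ n} {hb : b ∈ I ^ n} :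
    mk I n a ha = mk I n b hb ↔ a - b ∈ I ^ (n + 1) :=
  Submodule.Quotient.eq _

theorem mk_surj {n : ℕ} (x : Piece I n) : ∃ a ha, mk I n a ha = x := by
  obtain ⟨⟨a, ha⟩, rfl⟩ := Submodule.mkQ_surjective _ x
  exact ⟨a, ha, rfl⟩

theorem mk_add {n : ℕ} {a b : A} (ha : a ∈ I ^ n) (hb : b ∈ I ^ n) :
    mk I n a ha + mk I n b hb = mk I n (a + b) (add_mem ha hb) := rfl

theorem mk_zero (n : ℕ) : mk I n 0 (zero_mem _) = 0 := rfl

theorem mk_congr {n : ℕ} {a b : A} {ha : a ∈ I ^ n} {hb : b ∈ I ^ n} (h : a = b) :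
    mk I n a ha = mk I n b hb := by subst h; rfl

theorem mk_eq_zero {n : ℕ} {a : A} {ha : a ∈ I ^ n} (h : a ∈ I ^ (n + 1)) :
    mk I n a ha = 0 := by
  rw [← mk_zero, mk_eq_mk, sub_zero]; exact h

/-- Homomorphisms out of `Iⁿ / Iⁿ⁺¹`. -/
def lift {B : Type*} [AddCommGroup B] (n : ℕ) (f : ∀ a : A, a ∈ I ^ n → B)
    (hadd : ∀ a b ha hb, f (a + b) (add_mem ha hb) = f a ha + f b hb)
    (hzero : ∀ a ha, a ∈ I ^ (n + 1) → f a ha = 0) : Piece I n →+ B :=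
  QuotientAddGroup.lift (Submodule.comap (I ^ n).subtype (I ^ (n + 1))).toAddSubgroup
    (AddMonoidHom.mk' (fun a : ↥(I ^ n) => f a a.2) fun a b => hadd a b a.2 b.2)
    fun a ha => hzero a a.2 ha

@[simp] theorem lift_mk {B : Type*} [AddCommGroup B] {n : ℕ} (f : ∀ a : A, a ∈ I ^ n → B)
    (hadd : ∀ a b ha hb, f (a + b) (add_mem ha hb) = f a ha + f b hb)
    (hzero : ∀ a ha, a ∈ I ^ (n + 1) → f a ha = 0) (a : A) (ha : a ∈ I ^ n) :
    lift n f hadd hzero (mk I n a ha) = f a ha := rfl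

theorem mul_mem_pow {n m : ℕ} {a b : A} (ha : a ∈ I ^ n) (hb : b ∈ I ^ m) : a * b ∈ I ^ (n + m) := by
  rw [pow_add]; exact Ideal.mul_mem_mul ha hb

/-- Multiplication of classes, `(a + Iⁿ⁺¹)(b + Iᵐ⁺¹) = ab + Iⁿ⁺ᵐ⁺¹`. -/
def mulHom (n m : ℕ) : Piece I n →+ Piece I m →+ Piece I (n + m) :=
  lift n
    (fun a ha => lift m (fun b hb => mk I (n + m) (a * b) (mul_mem_pow ha hb))
      (fun b c _ _ => (mk_congr (mul_add a b c)).trans (mk_add _ _).symm)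
      (fun _ _ hb => mk_eq_zero (by rw [add_assoc]; exact mul_mem_pow ha hb)))
    (fun a a' ha ha' => by
      ext x
      obtain ⟨b, hb, rfl⟩ := mk_surj x
      exact (mk_congr (add_mul a a' b)).trans (mk_add _ _).symm)
    (fun _ _ h => by
      ext x
      obtain ⟨b, hb, rfl⟩ := mk_surj x
      refine mk_eq_zero ?_
      rw [add_right_comm]
      exact mul_mem_pow h hb)

theorem mulHom_mk {n m : ℕ} {a b : A} (ha : a ∈ I ^ n) (hb : b ∈ I ^ m) :
    mulHom n m (mk I n a ha) (mk I m b hb) = mk I (n + m) (a * b) (mul_mem_pow ha hb) := rfl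

theorem one_mem : (1 : A) ∈ I ^ 0 := by simp

theorem graded_mk_eq {n m : ℕ} {a b : A} (ha : a ∈ I ^ n) (hb : b ∈ I ^ m) (h : n = m)
    (h' : a = b) : GradedMonoid.mk (A := Piece I) n (mk I n a ha) =
      GradedMonoid.mk m (mk I m b hb) := by
  subst h; subst h'; rfl

instance : GradedMonoid.GMul (Piece I) := ⟨fun x y => mulHom _ _ x y⟩
instance : GradedMonoid.GOne (Piece I) := ⟨mk I 0 1 one_mem⟩

instance : DirectSum.GCommRing (Piece I) where
  mul_zero x := map_zero (mulHom _ _ x)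
  zero_mul y := DFunLike.congr_fun (map_zero (mulHom _ _)) y
  mul_add x y z := map_add (mulHom _ _ x) y z
  add_mul x y z := DFunLike.congr_fun (map_add (mulHom _ _) x y) z
  one_mul := by
    rintro ⟨n, x⟩
    obtain ⟨a, ha, rfl⟩ := mk_surj x
    exact graded_mk_eq _ _ (zero_add n) (one_mul a)
  mul_one := by
    rintro ⟨n, x⟩
    obtain ⟨a, ha, rfl⟩ := mk_surj x
    exact graded_mk_eq _ _ (add_zero n) (mul_one a)
  mul_assoc := by
    rintro ⟨n, x⟩ ⟨m, y⟩ ⟨k, z⟩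
    obtain ⟨a, ha, rfl⟩ := mk_surj x
    obtain ⟨b, hb, rfl⟩ := mk_surj y
    obtain ⟨c, hc, rfl⟩ := mk_surj z
    exact graded_mk_eq _ _ (add_assoc n m k) (mul_assoc a b c)
  mul_comm := by
    rintro ⟨n, x⟩ ⟨m, y⟩
    obtain ⟨a, ha, rfl⟩ := mk_surj x
    obtain ⟨b, hb, rfl⟩ := mk_surj y
    exact graded_mk_eq _ _ (add_comm n m) (mul_comm a b)
  natCast k := mk I 0 k (by simp)
  natCast_zero := by simp only [Nat.cast_zero]; rfl
  natCast_succ k := by simp only [Nat.cast_succ]; rfl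
  intCast k := mk I 0 k (by simp)
  intCast_ofNat k := by simp only [Int.cast_natCast]
  intCast_negSucc_ofNat k := by simp only [Int.cast_negSucc]; rfl

theorem of_mk_mul_of_mk {n m : ℕ} {a b : A} (ha : a ∈ I ^ n) (hb : b ∈ I ^ m) :
    DirectSum.of (Piece I) n (mk I n a ha) * DirectSum.of (Piece I) m (mk I m b hb) =
      DirectSum.of (Piece I) (n + m) (mk I (n + m) (a * b) (mul_mem_pow ha hb)) :=
  DirectSum.of_mul_of _ _

/-- The map `Iⁿ / Iⁿ⁺¹ → Jⁿ / Jⁿ⁺¹` induced by a ring homomorphism. -/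
def map {B : Type u} [CommRing B] {J : Ideal B} (f : A →+* B) (hf : I ≤ J.comap f) (n : ℕ) :
    Piece I n →+ Piece J n :=
  have key : ∀ k, ∀ a ∈ I ^ k, f a ∈ J ^ k := fun k _ ha =>
    (Ideal.le_comap_pow f k) (Ideal.pow_right_mono hf k ha)
  lift n (fun a ha => mk J n (f a) (key n a ha))
    (fun a b _ _ => (mk_congr (map_add f a b)).trans (mk_add _ _).symm)
    fun _ _ h => mk_eq_zero (key _ _ h)

theorem map_mk {B : Type u} [CommRing B] {J : Ideal B} (f : A →+* B) (hf : I ≤ J.comap f) (n : ℕ)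
    (a : A) (ha : a ∈ I ^ n) : map f hf n (mk I n a ha) =
      mk J n (f a) ((Ideal.le_comap_pow f n) (Ideal.pow_right_mono hf n ha)) := rfl

theorem two_mem (d : A →+* ZMod 2) : (2 : A) ∈ RingHom.ker d := by
  rw [RingHom.mem_ker, map_ofNat]; rfl

theorem two_mul_mem (d : A →+* ZMod 2) {n : ℕ} {a : A} (ha : a ∈ RingHom.ker d ^ n) :
    2 * a ∈ RingHom.ker d ^ (n + 1) := by
  rw [pow_succ']; exact Ideal.mul_mem_mul (two_mem d) ha

/-- Multiplication by `2` from `Iⁿ / Iⁿ⁺¹` to `Iⁿ⁺¹ / Iⁿ⁺²`. -/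
def two (d : A →+* ZMod 2) (n : ℕ) : Piece (RingHom.ker d) n →+ Piece (RingHom.ker d) (n + 1) :=
  lift n (fun a ha => mk _ (n + 1) (2 * a) (two_mul_mem d ha))
    (fun a b _ _ => (mk_congr (mul_add 2 a b)).trans (mk_add _ _).symm)
    fun _ _ h => mk_eq_zero (two_mul_mem d h)

/-- `2ⁿ + Iⁿ⁺¹`. -/
def top (d : A →+* ZMod 2) (n : ℕ) : Piece (RingHom.ker d) n :=
  mk _ n (2 ^ n) (Ideal.pow_mem_pow (two_mem d) n)

theorem two_eq (d : A →+* ZMod 2) (n : ℕ) (x : Piece (RingHom.ker d) n) :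
    DirectSum.of (Piece (RingHom.ker d)) 1 (top d 1) * DirectSum.of (Piece (RingHom.ker d)) n x =
      DirectSum.of (Piece (RingHom.ker d)) (n + 1) (two d n x) := by
  obtain ⟨a, ha, rfl⟩ := mk_surj x
  rw [DirectSum.of_mul_of]
  exact DirectSum.of_eq_of_gradedMonoid_eq
    (graded_mk_eq _ _ (add_comm 1 n) (congrArg (· * a) (pow_one 2)))

/-- The inductive graded ring of the powers of the kernel `I` of a ring homomorphism `A → 𝔽₂`:
`R_n = Iⁿ / Iⁿ⁺¹`, `⊤_n = 2ⁿ + Iⁿ⁺¹`, `h_n = 2 · _`. -/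
def igr (d : A →+* ZMod 2) : Igr.{u} where
  R := Piece (RingHom.ker d)
  top := top d
  h := two d
  zero_equiv := by
    refine ⟨AddEquiv.ofBijective
      (lift 0 (fun a _ => d a) (fun a b _ _ => map_add d a b) ?_) ⟨?_, ?_⟩⟩
    · intro a _ h
      simpa [RingHom.mem_ker] using h
    · rw [injective_iff_map_eq_zero]
      intro x hx
      obtain ⟨a, ha, rfl⟩ := mk_surj x
      refine mk_eq_zero ?_
      simpa [RingHom.mem_ker] using hx
    · intro z
      obtain ⟨a, rfl⟩ := ZMod.ringHom_surjective d z
      exact ⟨mk _ 0 a (by simp), rfl⟩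
  add_self_eq n x := by
    obtain ⟨a, ha, rfl⟩ := mk_surj x
    rw [mk_add]
    refine mk_eq_zero ?_
    rw [← two_mul]
    exact two_mul_mem d ha
  top_zero := congrArg (DirectSum.of _ 0) (mk_congr (pow_zero 2))
  h_top n := mk_congr (pow_succ' 2 n).symm
  h_eq n _ x := two_eq d n x
  h_mul := Igr.iterH_mul (top d 1) (two d) (two_eq d)

/-- Functoriality of `igr`. -/
def igrMap {B : Type u} [CommRing B] {d : A →+* ZMod 2} {e : B →+* ZMod 2} (f : A →+* B)
    (hf : RingHom.ker d ≤ (RingHom.ker e).comap f) : igr d ⟶ igr e where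
  app := map f hf
  map_top n := mk_congr (by rw [map_pow, map_ofNat])
  map_mul n m x y := by
    obtain ⟨a, ha, rfl⟩ := mk_surj x
    obtain ⟨b, hb, rfl⟩ := mk_surj y
    exact mk_congr (map_mul f a b)

end Gr

namespace SpecialGroup

/-! ### The category of special groups -/

/-- Morphisms of special groups. -/
@[ext] structure Hom (G H : Type u) [SpecialGroup G] [SpecialGroup H] : Type u where
  toHom : G →* H
  map_negOne : toHom negOne = negOne
  map_eqv : ∀ a b c d, Eqv a b c d → Eqv (toHom a) (toHom b) (toHom c) (toHom d)

namespace Hom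

variable {G H K : Type u} [SpecialGroup G] [SpecialGroup H] [SpecialGroup K]

theorem chain (f : Hom G H) {φ ψ : List G} (h : Chain φ ψ) :
    Chain (φ.map f.toHom) (ψ.map f.toHom) := by
  have key : ∀ {φ ψ : List G}, Step φ ψ → Step (φ.map f.toHom) (ψ.map f.toHom) := by
    intro φ ψ h
    induction h with
    | head l h => exact .head _ (f.map_eqv _ _ _ _ h)
    | tail a _ ih => exact .tail _ ih
  induction h with
  | refl => exact .refl _
  | tail _ s ih => exact Relation.ReflTransGen.tail ih (key s)

theorem map_hyp (f : Hom G H) (m : ℕ) : (hyp G m).map f.toHom = hyp H m := by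
  induction m with
  | zero => rfl
  | succ m ih => simp [hyp, f.map_negOne, ih]

theorem witt (f : Hom G H) {φ ψ : List G} (h : WittEquiv φ ψ) :
    WittEquiv (φ.map f.toHom) (ψ.map f.toHom) := by
  obtain ⟨m, n, h⟩ := wittEquiv_iff.1 h
  refine wittEquiv_iff.2 ⟨m, n, ?_⟩
  simpa only [List.map_append, f.map_hyp] using f.chain h

theorem map_neg (f : Hom G H) (a : G) : f.toHom (neg a) = neg (f.toHom a) := by
  simp [neg, f.map_negOne]

end Hom

variable {G H K : Type u} [SpecialGroup G] [SpecialGroup H] [SpecialGroup K]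

/-- `W(f) : W(G) → W(H)`, `⟨a₁,…,aₙ⟩ ↦ ⟨f(a₁),…,f(aₙ)⟩`. -/
def Witt.map (f : Hom G H) : Witt G →+* Witt H where
  toFun := Quotient.map (List.map f.toHom) fun _ _ h => f.witt h
  map_zero' := rfl
  map_one' := by
    change Witt.mk ([1].map f.toHom) = Witt.mk [1]
    simp
  map_add' x y := by
    obtain ⟨φ, rfl⟩ := Witt.mk_surj x
    obtain ⟨ψ, rfl⟩ := Witt.mk_surj y
    change Witt.mk ((φ ++ ψ).map f.toHom) = Witt.mk (φ.map f.toHom ++ ψ.map f.toHom)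
    simp
  map_mul' x y := by
    obtain ⟨φ, rfl⟩ := Witt.mk_surj x
    obtain ⟨ψ, rfl⟩ := Witt.mk_surj y
    change Witt.mk ((tensor φ ψ).map f.toHom) =
      Witt.mk (tensor (φ.map f.toHom) (ψ.map f.toHom))
    simp [tensor, List.map_flatMap, List.flatMap_map, Function.comp_def]

theorem Witt.map_mk (f : Hom G H) (φ : List G) :
    Witt.map f (Witt.mk φ) = Witt.mk (φ.map f.toHom) := rfl

theorem Witt.ker_le (f : Hom G H) :
    RingHom.ker (dim2 G) ≤ (RingHom.ker (dim2 H)).comap (Witt.map f) := by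
  intro x hx
  obtain ⟨φ, rfl⟩ := Witt.mk_surj x
  rw [Ideal.mem_comap, RingHom.mem_ker, Witt.map_mk, dim2_mk, List.length_map]
  exact hx

/-! ### Reduced K-theory -/

variable (G) in
/-- The defining relations of the ring `k_*(G) = K_*(G) / 2 K_*(G)`: it is the tensor algebra over
`ℤ` of the group `G` written additively, modulo `l(a) ⊗ l(b)` for `b ∈ D_G(⟨1,-a⟩)`, and modulo
`2`. -/
inductive KRel : TensorAlgebra ℤ (Additive G) → TensorAlgebra ℤ (Additive G) → Prop
  | mul (a b : G) : Represents [1, neg a] b →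
      KRel (TensorAlgebra.ι ℤ (Additive.ofMul a) * TensorAlgebra.ι ℤ (Additive.ofMul b)) 0
  | two : KRel 2 0

variable (G) in
/-- The ring `k_*(G)`. -/
def KRing : Type u := RingQuot (KRel G)

noncomputable section

instance : Ring (KRing G) := inferInstanceAs (Ring (RingQuot (KRel G)))

/-- The quotient map. -/
def KRing.proj : TensorAlgebra ℤ (Additive G) →+* KRing G := RingQuot.mkRingHom (KRel G)

theorem KRing.proj_surj : Function.Surjective (KRing.proj (G := G)) :=
  RingQuot.mkRingHom_surjective _

/-- `l : G → k_1(G)`. -/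
def KRing.l (a : G) : KRing G := KRing.proj (TensorAlgebra.ι ℤ (Additive.ofMul a))

namespace KRing

theorem l_mul (a b : G) : l (a * b) = l a + l b := by
  simp [l, ofMul_mul]

theorem l_mul_l {a b : G} (h : Represents [1, neg a] b) : l a * l b = 0 := by
  rw [l, l, ← map_mul, ← map_zero proj]
  exact RingQuot.mkRingHom_rel (KRel.mul a b h)

theorem two_eq_zero : (2 : KRing G) = 0 := by
  have := RingQuot.mkRingHom_rel (KRel.two (G := G))
  rw [map_zero, map_ofNat] at this
  exact this

theorem add_self (x : KRing G) : x + x = 0 := by rw [← two_mul, two_eq_zero, zero_mul]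

theorem l_mul_neg (a : G) : l a * l (neg a) = 0 :=
  l_mul_l ⟨[1], .pair (sg1 _ _)⟩

theorem neg_mul (a b : G) : neg (a * b) = a * neg b := by
  simp only [neg]; exact mul_left_comm _ _ _

theorem l_comm (a b : G) : l a * l b = l b * l a := by
  have h := l_mul_neg (a * b)
  have e₁ : l a * l (neg (a * b)) = l a * l b := by
    rw [mul_comm a b, neg_mul, l_mul, mul_add, l_mul_neg, add_zero]
  have e₂ : l b * l (neg (a * b)) = l b * l a := by
    rw [neg_mul, l_mul, mul_add, l_mul_neg, add_zero]
  rw [l_mul, add_mul, e₁, e₂] at h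
  calc l a * l b = l a * l b + (l b * l a + l b * l a) := by rw [add_self, add_zero]
    _ = l b * l a := by rw [← add_assoc, h, zero_add]

theorem ring_comm (x y : KRing G) : x * y = y * x := by
  have key : ∀ z : KRing G, (∀ a, l a * z = z * l a) → ∀ x, x * z = z * x := by
    intro z hz x
    obtain ⟨t, rfl⟩ := proj_surj x
    induction t using TensorAlgebra.induction with
    | algebraMap r =>
      rw [eq_intCast, map_intCast]
      exact Int.cast_commute r z
    | ι m => exact hz m.toMul
    | mul a b ha hb => rw [map_mul, mul_assoc, hb, ← mul_assoc, ha, mul_assoc]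
    | add a b ha hb => rw [map_add, add_mul, mul_add, ha, hb]
  exact key y (fun a => (key (l a) (fun b => l_comm b a) y).symm) x

instance : CommRing (KRing G) where
  mul_comm := ring_comm

/-- Ring homomorphisms out of `k_*(G)`. -/
def lift {A : Type*} [Ring A] (f : Additive G →+ A)
    (hf : ∀ a b : G, Represents [1, neg a] b → f (.ofMul a) * f (.ofMul b) = 0)
    (h2 : (2 : A) = 0) : KRing G →+* A :=
  RingQuot.lift ⟨(TensorAlgebra.lift ℤ f.toIntLinearMap).toRingHom, by
    intro x y h
    cases h with
    | mul a b h => simpa using hf a b h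
    | two => rw [map_zero, map_ofNat]; exact h2⟩

theorem lift_proj {A : Type*} [Ring A] (f : Additive G →+ A)
    (hf : ∀ a b : G, Represents [1, neg a] b → f (.ofMul a) * f (.ofMul b) = 0)
    (h2 : (2 : A) = 0) (t : TensorAlgebra ℤ (Additive G)) :
    lift f hf h2 (proj t) = TensorAlgebra.lift ℤ f.toIntLinearMap t := by
  exact RingQuot.lift_mkRingHom_apply _ _ _

theorem lift_l {A : Type*} [Ring A] (f : Additive G →+ A)
    (hf : ∀ a b : G, Represents [1, neg a] b → f (.ofMul a) * f (.ofMul b) = 0)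
    (h2 : (2 : A) = 0) (a : G) : lift f hf h2 (l a) = f (.ofMul a) := by
  rw [l, lift_proj]; simp

variable (G) in
/-- The logarithm `l : G → k_*(G)` as a homomorphism. -/
def lHom : Additive G →+ KRing G := AddMonoidHom.mk' (fun a => l a.toMul) fun _ _ => l_mul _ _

variable (G) in
/-- `k_n(G)`: the image in `k_*(G)` of the `n`-th tensor power of `G`. As the relations are
homogeneous, it is the quotient of the `n`-th tensor power by `2` and by the tensors
`l(a₁) ⊗ ⋯ ⊗ l(aₙ)` with `aᵢ₊₁ ∈ D_G(⟨1,-aᵢ⟩)` for some `i`. -/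
def degree (n : ℕ) : Submodule ℤ (KRing G) := LinearMap.range (lHom G).toIntLinearMap ^ n

instance : SetLike.GradedMonoid (degree G) :=
  inferInstanceAs (SetLike.GradedMonoid fun n : ℕ =>
    LinearMap.range (lHom G).toIntLinearMap ^ n)

theorem l_mem (a : G) : l a ∈ degree G 1 := by
  rw [degree, pow_one]; exact ⟨.ofMul a, rfl⟩

/-- `l(g₁) ⋯ l(gₙ) ∈ k_n(G)`. -/
theorem prod_l_mem {n : ℕ} (g : Fin n → G) : ∏ i, l (g i) ∈ degree G n := by
  have := SetLike.prod_mem_graded (A := degree G) (F := Finset.univ) (fun _ : Fin n => 1)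
    (fun i => l (g i)) fun i _ => l_mem (g i)
  simpa using this

theorem top_mem (n : ℕ) : (l negOne : KRing G) ^ n ∈ degree G n := by
  simpa using prod_l_mem (fun _ : Fin n => (negOne : G))

theorem l_mul_mem {n : ℕ} {x : KRing G} (a : G) (hx : x ∈ degree G n) :
    l a * x ∈ degree G (n + 1) := by
  rw [add_comm]
  exact SetLike.mul_mem_graded (l_mem a) hx

theorem mem_degree_zero {x : KRing G} (hx : x ∈ degree G 0) : ∃ z : ℤ, x = z := by
  rw [degree, pow_zero, Submodule.mem_one] at hx
  obtain ⟨z, rfl⟩ := hx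
  exact ⟨z, by simp⟩

/-- Multiplication by `l(-1)` from `k_n(G)` to `k_{n+1}(G)`. -/
def omega (n : ℕ) : degree G n →+ degree G (n + 1) :=
  AddMonoidHom.mk' (fun x => ⟨l negOne * x.1, l_mul_mem _ x.2⟩)
    fun x y => Subtype.ext (mul_add _ x.1 y.1)

theorem omega_eq (n : ℕ) (x : degree G n) :
    DirectSum.of (fun i => degree G i) 1 ⟨l negOne ^ 1, top_mem 1⟩ *
        DirectSum.of (fun i => degree G i) n x =
      DirectSum.of (fun i => degree G i) (n + 1) (omega n x) := by
  rw [DirectSum.of_mul_of]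
  refine DirectSum.of_eq_of_gradedMonoid_eq (Sigma.subtype_ext (add_comm 1 n) ?_)
  change l negOne ^ 1 * x.1 = l negOne * x.1
  rw [pow_one]

variable (G) in
/-- The reduced K-theory of `G` as an inductive graded ring. -/
def igr : Igr.{u} where
  R n := degree G n
  top n := ⟨l negOne ^ n, top_mem n⟩
  h := omega
  zero_equiv := by
    let e : KRing G →+* ZMod 2 := lift (0 : Additive G →+ ZMod 2) (fun _ _ _ => by simp) rfl
    refine ⟨AddEquiv.ofBijective
      ((e : KRing G →+ ZMod 2).comp (degree G 0).subtype.toAddMonoidHom) ⟨?_, ?_⟩⟩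
    · rw [injective_iff_map_eq_zero]
      rintro ⟨x, hx⟩ h
      obtain ⟨z, rfl⟩ := mem_degree_zero hx
      have h' : (z : ZMod 2) = 0 := by rw [← map_intCast e z]; exact h
      obtain ⟨w, rfl⟩ := (ZMod.intCast_zmod_eq_zero_iff_dvd z 2).1 h'
      apply Subtype.ext
      change (((2 : ℕ) : ℤ) * w : ℤ) = (0 : KRing G)
      rw [Int.cast_mul]
      have : (((2 : ℕ) : ℤ) : KRing G) = 0 := by simpa using two_eq_zero (G := G)
      rw [this, zero_mul]
    · intro z
      obtain ⟨w, rfl⟩ := ZMod.intCast_surjective z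
      refine ⟨⟨w, ?_⟩, map_intCast e w⟩
      rw [degree, pow_zero, Submodule.mem_one]
      exact ⟨w, by simp⟩
  add_self_eq n x := Subtype.ext (add_self (x : KRing G))
  top_zero := congrArg (DirectSum.of _ 0) (Subtype.ext (pow_zero _))
  h_top n := Subtype.ext (pow_succ' (l negOne : KRing G) n).symm
  h_eq n _ x := omega_eq n x
  h_mul := Igr.iterH_mul _ _ omega_eq

/-- `k(f) : k_*(G) → k_*(H)`, `l(a) ↦ l(f(a))`. -/
def map (f : Hom G H) : KRing G →+* KRing H :=
  lift ((lHom H).comp (MonoidHom.toAdditive f.toHom))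
    (fun a b h => by
      refine l_mul_l (G := H) ?_
      obtain ⟨t, ht⟩ := h
      refine ⟨t.map f.toHom, isom_iff_chain.2 ?_⟩
      simpa [f.map_neg] using f.chain ht.chain)
    two_eq_zero

theorem map_l (f : Hom G H) (a : G) : map f (l a) = l (f.toHom a) := lift_l _ _ _ a

theorem map_mem (f : Hom G H) {n : ℕ} {x : KRing G} (hx : x ∈ degree G n) :
    map f x ∈ degree H n := by
  have h : degree G n ≤ (degree H n).comap (map f).toIntAlgHom.toLinearMap := by
    rw [← Submodule.map_le_iff_le_comap, degree, Submodule.map_pow]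
    refine pow_le_pow_left' ?_ n
    rintro _ ⟨_, ⟨a, rfl⟩, rfl⟩
    exact ⟨.ofMul (f.toHom a.toMul), (map_l f a.toMul).symm⟩
  exact h hx

/-- Functoriality of the reduced K-theory. -/
def igrMap (f : Hom G H) : igr G ⟶ igr H where
  app n := AddMonoidHom.mk' (fun x : degree G n => (⟨map f x, map_mem f x.2⟩ : degree H n))
    fun _ _ => Subtype.ext (map_add _ _ _)
  map_top n := Subtype.ext (by
    change map f (l negOne ^ n) = l negOne ^ n
    rw [map_pow, map_l, f.map_negOne])
  map_mul n m x y := Subtype.ext (map_mul (map f) _ _)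

theorem hom_ext {A : Type*} [Ring A] {p q : KRing G →+* A} (h : ∀ a, p (l a) = q (l a)) :
    p = q := by
  ext x
  obtain ⟨t, rfl⟩ := proj_surj x
  induction t using TensorAlgebra.induction with
  | algebraMap r => rw [eq_intCast, map_intCast, map_intCast, map_intCast]
  | ι m => exact h m.toMul
  | mul a b ha hb => rw [map_mul, map_mul, map_mul, ha, hb]
  | add a b ha hb => rw [map_add, map_add, map_add, ha, hb]

end KRing

end

end SpecialGroup

open CategoryTheory

/-- The category of special groups. -/
structure SG : Type (u + 1) where
  carrier : Type u
  [str : SpecialGroup carrier]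

namespace SG

open SpecialGroup

instance : CoeSort SG.{u} (Type u) := ⟨SG.carrier⟩

attribute [instance] SG.str

instance : Category.{u} SG.{u} where
  Hom G H := SpecialGroup.Hom G H
  id G := ⟨MonoidHom.id G, rfl, fun _ _ _ _ h => h⟩
  comp f g := ⟨g.toHom.comp f.toHom, by simp [f.map_negOne, g.map_negOne],
    fun _ _ _ _ h => g.map_eqv _ _ _ _ (f.map_eqv _ _ _ _ h)⟩

/-- The functor `Grad ∘ W`, `G ↦ (Iⁿ(G) / Iⁿ⁺¹(G))ₙ`. -/
def gradW : SG.{u} ⥤ Igr.{u} where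
  obj G := Gr.igr (dim2 G)
  map {G H} f := Gr.igrMap (Witt.map f) (Witt.ker_le f)
  map_id G := Igr.Hom.ext <| funext fun n => AddMonoidHom.ext fun x => by
    obtain ⟨a, ha, rfl⟩ := Gr.mk_surj x
    obtain ⟨φ, rfl⟩ := Witt.mk_surj a
    exact Gr.mk_congr (congrArg Witt.mk (List.map_id φ))
  map_comp {G H K} f g := Igr.Hom.ext <| funext fun n => AddMonoidHom.ext fun x => by
    obtain ⟨a, ha, rfl⟩ := Gr.mk_surj x
    obtain ⟨φ, rfl⟩ := Witt.mk_surj a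
    exact Gr.mk_congr (congrArg Witt.mk (List.map_map (f := f.toHom) (g := g.toHom) (l := φ)).symm)

/-- The functor `k` of reduced K-theory, `G ↦ (k_n(G))ₙ`. -/
noncomputable def k : SG.{u} ⥤ Igr.{u} where
  obj G := KRing.igr G
  map {G H} f := KRing.igrMap f
  map_id G := Igr.Hom.ext <| funext fun n => AddMonoidHom.ext fun x => Subtype.ext <| by
    have : KRing.map (𝟙 G : G ⟶ G) = RingHom.id (KRing G) :=
      KRing.hom_ext fun a => KRing.map_l _ a
    exact DFunLike.congr_fun this (Subtype.val (p := (· ∈ KRing.degree G n)) x)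
  map_comp {G H K} f g := Igr.Hom.ext <| funext fun n => AddMonoidHom.ext fun x => Subtype.ext <| by
    have : KRing.map (f ≫ g) = (KRing.map g).comp (KRing.map f) :=
      KRing.hom_ext fun a => by
        rw [RingHom.comp_apply, KRing.map_l, KRing.map_l, KRing.map_l]; rfl
    exact DFunLike.congr_fun this (Subtype.val (p := (· ∈ KRing.degree G n)) x)

variable (G : SG.{u})

/-- The generator `l(a)` of `k_1(G)`. -/
noncomputable def l (a : G) : (k.obj G).R 1 := (⟨KRing.l a, KRing.l_mem a⟩ : KRing.degree G 1)

/-- The generator `l(g₁) ⊗ ⋯ ⊗ l(gₙ)` of `k_n(G)`. -/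
noncomputable def symbol {n : ℕ} (g : Fin n → G) : (k.obj G).R n :=
  (⟨∏ i, KRing.l (g i), KRing.prod_l_mem g⟩ : KRing.degree G n)

theorem pfister_mem {n : ℕ} (g : Fin n → G) :
    ∏ i, Witt.mk [1, neg (g i)] ∈ RingHom.ker (dim2 G) ^ n := by
  have h : ∀ i, Witt.mk [1, neg (g i)] ∈ RingHom.ker (dim2 G) := fun i => by
    rw [RingHom.mem_ker, dim2_mk]; exact (rfl : ((2 : ℕ) : ZMod 2) = 0)
  simpa using Ideal.prod_mem_prod (s := Finset.univ) (I := fun _ : Fin n => RingHom.ker (dim2 G))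
    fun i _ => h i

/-- The class in `Iⁿ(G) / Iⁿ⁺¹(G)` of the Pfister form `⟨1,-g₁⟩ ⊗ ⋯ ⊗ ⟨1,-gₙ⟩`. -/
def pfister {n : ℕ} (g : Fin n → G) : (gradW.obj G).R n :=
  Gr.mk _ n (∏ i, Witt.mk [1, neg (g i)]) (pfister_mem G g)

/-- `G` is an [SMC] group: it is reduced, and multiplication by `l(-1)` is injective on `k_n(G)`
for all `n ≥ 1`. -/
def IsSMC : Prop :=
  IsReduced G ∧ ∀ n : ℕ, 1 ≤ n → Function.Injective fun x : (k.obj G).R n =>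
    (GradedMonoid.GMul.mul (l G negOne) x : (k.obj G).R (1 + n))

end SG

/-! The map $s$ comes from presenting $k_*(G)$ by generators and relations. In $W(G)$ one has
$\langle1,-ab\rangle=\langle1,-a\rangle+\langle1,-b\rangle-\langle1,-a\rangle\langle1,-b\rangle$, so
$a\mapsto\langle1,-a\rangle+I^2$ is additive. If $b\in D_G(\langle1,-a\rangle)$, then
$\langle1,-a\rangle\equiv b\langle1,-a\rangle$, hence $\langle1,-a\rangle\langle1,-b\rangle=0$.
Surjectivity in positive degree holds because $I^n$ is additively generated by $n$-fold Pfister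
forms (`pow_ker_le_pfisterSpan`).

The maps $r_n$ are Stiefel-Whitney classes. If $\langle a,b\rangle\equiv\langle c,d\rangle$, then
$l(a)l(b)=l(c)l(d)$ (`KRing.l_mul_l_of_eqv`), so $\prod(1+l(a_i)t)\in k_*(G)[[t]]^\times$ is an
isometry invariant. A hyperbolic plane has class $1+l(-1)t$. Dividing by this unit to the power of
half the dimension gives a function on $W(G)$ that turns sums into products on $I$. The class of an
$(n+1)$-fold Pfister form is the inverse of $1+l(-1)^{2^n-(n+1)}l(g_1)\cdots l(g_{n+1})\,t^{2^n}$
(`sw_mul_pfister`). Hence on $I^{n+1}$ the class is $1$ modulo $t^{2^n}$, its coefficient in degree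
$2^n$ is additive, and this coefficient vanishes on $I^{n+2}$, where the class starts only in degree
$2^{n+1}$. This coefficient is $r_{n+1}$.

On symbols $r_ns_n$ is multiplication by $l(-1)^{2^{n-1}-n}$, hence everywhere. The exponent is $0$
for $n=1,2$, and under [SMC] every power of $l(-1)$ acts injectively in positive degree; in both
cases $s_n$ is injective. In degree $0$ a surjection between groups of order $2$ is bijective. -/

namespace SpecialGroup

variable {G : Type u} [SpecialGroup G]

/-! ### Binary isometries and symbol identities in $k_*(G)$ -/

/-- Scaling $\langle a,b\rangle\equiv\langle c,d\rangle$ by $a$ gives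
$\langle1,ab\rangle\equiv\langle ac,ad\rangle$, since $a^2=1$. -/
theorem Eqv.represents {a b c d : G} (h : Eqv a b c d) : Represents [1, a * b] (a * c) := by
  refine ⟨[a * d], .pair (sg0_symm _ _ _ _ ?_)⟩
  simpa only [mul_self_eq] using sg5 _ _ _ _ a h

/-- The discriminant (SG3) forces the second entry: $\langle1,a\rangle\equiv\langle b,d\rangle$
gives $a=bd$, so $d=ba$. -/
theorem represents_pair {a b : G} (h : Represents [1, a] b) : Eqv 1 a b (b * a) := by
  obtain ⟨t, ht⟩ := h
  obtain ⟨c, d, e, h'⟩ := ht.chain.symm.pair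
  simp only [List.cons.injEq] at e
  obtain ⟨rfl, -⟩ := e
  have hd : b * a = d := by
    have := sg3 _ _ _ _ h'
    rw [one_mul] at this
    rw [this, ← mul_assoc, mul_self_eq, one_mul]
  rwa [hd]

namespace KRing

theorem l_one : l (1 : G) = 0 := by
  have := l_mul (1 : G) 1
  rwa [mul_one, left_eq_add] at this

theorem l_neg (a : G) : l (neg a) = l negOne + l a := l_mul _ _

theorem l_mul_self (a : G) : l a * l a = l negOne * l a := by
  have h := l_mul_neg a
  rw [l_neg, mul_add] at h
  linear_combination h - add_self (l negOne * l a)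

/-- Since $ac\in D_G(\langle1,ab\rangle)$, the defining relation gives $l(-ab)\,l(ac)=0$. Expanding
with $l(x)^2=l(-1)l(x)$ and $l(a)+l(b)=l(c)+l(d)$ leaves $l(a)l(b)+l(c)l(d)=0$ modulo $2$. -/
theorem l_mul_l_of_eqv {a b c d : G} (h : Eqv a b c d) : l a * l b = l c * l d := by
  have h₁ : l (neg (a * b)) * l (a * c) = 0 := by
    refine l_mul_l ?_
    have : neg (neg (a * b)) = a * b := by
      rw [neg, neg, ← mul_assoc, mul_self_eq, one_mul]
    rw [this]
    exact h.represents
  have h₂ : (l a + l b : KRing G) = l c + l d := by rw [← l_mul, ← l_mul, sg3 _ _ _ _ h]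
  rw [l_neg, l_mul, l_mul] at h₁
  linear_combination h₁ - l_mul_self a - l_mul_self c - l c * h₂ - add_self (l negOne * l a) -
    add_self (l negOne * l c) - add_self (l c * l d)

/-- The $n$-th power of the span of a set is the span of its $n$-fold products. Additive statements
about $k_n(G)$ can therefore be checked on symbols. -/
theorem degree_eq_span (n : ℕ) :
    degree G n = Submodule.span ℤ (Set.range fun g : Fin n → G => ∏ i, l (g i)) := by
  have h : LinearMap.range (lHom G).toIntLinearMap =
      Submodule.span ℤ (Set.range (l : G → KRing G)) := by
    refine le_antisymm ?_ (Submodule.span_le.2 ?_)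
    · rintro _ ⟨a, rfl⟩
      exact Submodule.subset_span ⟨a.toMul, rfl⟩
    · rintro _ ⟨a, rfl⟩
      exact ⟨.ofMul a, rfl⟩
  rw [degree, h, Submodule.span_pow]
  congr 1
  ext x
  rw [Set.mem_pow]
  constructor
  · rintro ⟨f, rfl⟩
    choose g hg using fun i => (f i).2
    exact ⟨g, by simp [List.prod_ofFn, hg]⟩
  · rintro ⟨g, rfl⟩
    exact ⟨fun i => ⟨l (g i), g i, rfl⟩, by simp [List.prod_ofFn]⟩

/-- Homomorphisms out of `k_n(G)` are determined by their values on the generators. -/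
theorem degree_hom_ext {B : Type*} [AddCommGroup B] {n : ℕ} {p q : degree G n →+ B}
    (h : ∀ g : Fin n → G, p ⟨∏ i, l (g i), prod_l_mem g⟩ = q ⟨∏ i, l (g i), prod_l_mem g⟩) :
    p = q := by
  ext ⟨x, hx⟩
  have hx' := hx
  rw [degree_eq_span] at hx'
  induction hx' using Submodule.span_induction with
  | mem x h' => obtain ⟨g, rfl⟩ := h'; exact h g
  | zero => exact (map_zero p).trans (map_zero q).symm
  | add x y hx' hy' ihx ihy =>
    rw [← degree_eq_span] at hx' hy'
    exact (map_add p ⟨x, hx'⟩ ⟨y, hy'⟩).trans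
      ((congrArg₂ (· + ·) (ihx hx') (ihy hy')).trans (map_add q ⟨x, hx'⟩ ⟨y, hy'⟩).symm)
  | smul z x hx' ih =>
    rw [← degree_eq_span] at hx'
    exact (map_zsmul p z ⟨x, hx'⟩).trans
      ((congrArg (z • ·) (ih hx')).trans (map_zsmul q z ⟨x, hx'⟩).symm)

end KRing

/-! ### The fundamental ideal -/

theorem Witt.mk_cons (a : G) (φ : List G) : mk (a :: φ) = mk [a] + mk φ := rfl

theorem Witt.mk_mul_single (a b : G) : mk [a] * mk [b] = mk [a * b] := rfl

theorem Witt.mk_neg_single (a : G) : mk [neg a] = -mk [a] := rfl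

theorem Witt.mk_pfister (a : G) : mk [1, neg a] = 1 - mk [a] := by
  rw [mk_cons, mk_neg_single, ← one_def, sub_eq_add_neg]

theorem Witt.pfister_mem (a : G) : mk [1, neg a] ∈ RingHom.ker (dim2 G) := by
  rw [RingHom.mem_ker, dim2_mk]
  exact (rfl : ((2 : ℕ) : ZMod 2) = 0)

theorem Witt.mk_mem_closure : ∀ φ : List G, Even φ.length →
    mk φ ∈ AddSubgroup.closure (Set.range fun a : G => mk [1, neg a])
  | [], _ => zero_mem _
  | [_], h => by simp at h
  | a :: b :: φ, h => by
    have ih := mk_mem_closure φ (by simpa [Nat.even_add_one] using h)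
    -- Entries are removed in pairs: $\langle a,b\rangle=(1+\langle b\rangle)-(1-\langle a\rangle)$,
    -- a difference of Pfister forms with parameters $-b$ and $a$.
    have e : mk (a :: b :: φ) = mk [1, neg (neg b)] - mk [1, neg a] + mk φ := by
      rw [mk_cons, mk_cons b, mk_pfister, mk_pfister, mk_neg_single]
      ring
    rw [e]
    exact add_mem (sub_mem (AddSubgroup.subset_closure ⟨_, rfl⟩)
      (AddSubgroup.subset_closure ⟨_, rfl⟩)) ih

theorem Witt.ker_le_closure {x : Witt G} (hx : x ∈ RingHom.ker (dim2 G)) :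
    x ∈ AddSubgroup.closure (Set.range fun a : G => mk [1, neg a]) := by
  obtain ⟨φ, rfl⟩ := mk_surj x
  refine mk_mem_closure φ ?_
  rw [RingHom.mem_ker, dim2_mk] at hx
  exact ZMod.natCast_eq_zero_iff_even.1 hx

variable (G) in
/-- The additive group generated by the classes of the `n`-fold Pfister forms. -/
def pfisterSpan (n : ℕ) : AddSubgroup (Witt G) :=
  AddSubgroup.closure (Set.range fun g : Fin n → G => ∏ i, Witt.mk [1, neg (g i)])

/-- By bilinearity it suffices to multiply a $1$-fold by an $n$-fold Pfister form, which gives an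
$(n+1)$-fold one. -/
theorem mul_mem_pfisterSpan {n : ℕ} {x y : Witt G} (hx : x ∈ RingHom.ker (dim2 G))
    (hy : y ∈ pfisterSpan G n) : x * y ∈ pfisterSpan G (n + 1) := by
  induction hy using AddSubgroup.closure_induction with
  | zero => rw [mul_zero]; exact zero_mem _
  | add y z _ _ ihy ihz => rw [mul_add]; exact add_mem ihy ihz
  | neg y _ ih => rw [mul_neg]; exact neg_mem ih
  | mem y h =>
    obtain ⟨g, rfl⟩ := h
    replace hx := Witt.ker_le_closure hx
    induction hx using AddSubgroup.closure_induction with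
    | zero => rw [zero_mul]; exact zero_mem _
    | add y z _ _ ihy ihz =>
      rw [add_mul]
      exact add_mem ihy ihz
    | neg y _ ih => rw [neg_mul]; exact neg_mem ih
    | mem y h =>
      obtain ⟨a, rfl⟩ := h
      refine AddSubgroup.subset_closure ⟨Fin.cons a g, ?_⟩
      simp [Fin.prod_univ_succ]

/-- `Iⁿ⁺¹` is additively generated by the `(n+1)`-fold Pfister forms. -/
theorem pow_ker_le_pfisterSpan {n : ℕ} {x : Witt G} (hx : x ∈ RingHom.ker (dim2 G) ^ (n + 1)) :
    x ∈ pfisterSpan G (n + 1) := by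
  induction n generalizing x with
  | zero =>
    rw [zero_add, pow_one] at hx
    -- The empty product $1$ is the only $0$-fold Pfister form. It need not generate $I^0=W(G)$
    -- additively, so the induction starts at $I^1$.
    simpa using mul_mem_pfisterSpan (y := 1) hx (n := 0)
      (AddSubgroup.subset_closure ⟨Fin.elim0, by simp⟩)
  | succ n ih =>
    rw [pow_succ'] at hx
    exact Submodule.mul_induction_on hx (fun x hx y hy => mul_mem_pfisterSpan hx (ih hy))
      fun _ _ => add_mem

end SpecialGroup

namespace SpecialGroup

variable {G : Type u} [SpecialGroup G]

/-! ### Stiefel-Whitney classes -/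

namespace StiefelWhitney

open PowerSeries

/-- The element `l(a) t` of `k_*(G)[[t]]`. -/
noncomputable def lX (a : G) : PowerSeries (KRing G) := C (KRing.l a) * X

theorem lX_mul (a b : G) : lX (a * b) = lX a + lX b := by
  rw [lX, lX, lX, KRing.l_mul, map_add, add_mul]

theorem lX_one : lX (1 : G) = 0 := by rw [lX, KRing.l_one, map_zero, zero_mul]

theorem lX_mul_self (a : G) : lX a * lX a = lX negOne * lX a := by
  have := congrArg (C (R := KRing G)) (KRing.l_mul_self a)
  rw [map_mul, map_mul] at this
  rw [lX, lX]
  linear_combination X ^ 2 * this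

theorem two_eq_zero : (2 : PowerSeries (KRing G)) = 0 := by
  have := congrArg (C (R := KRing G)) KRing.two_eq_zero
  rwa [map_zero, map_ofNat] at this

theorem isUnit_one_add {R : Type*} [CommRing R] {f : PowerSeries R} (hf : X ∣ f) :
    IsUnit (1 + f) := by
  rw [PowerSeries.isUnit_iff_constantCoeff, map_add, X_dvd_iff.1 hf]
  simp

theorem X_dvd_lX (a : G) : X ∣ lX a := Dvd.intro_left _ rfl

/-- The unit `1 + l(a) t` of `k_*(G)[[t]]`. -/
noncomputable def unit (a : G) : (PowerSeries (KRing G))ˣ := (isUnit_one_add (X_dvd_lX a)).unit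

theorem val_unit (a : G) : (unit a : PowerSeries (KRing G)) = 1 + lX a := rfl

/-- The linear terms agree because the discriminants do, the quadratic terms by
`KRing.l_mul_l_of_eqv`. -/
theorem unit_mul_of_eqv {a b c d : G} (h : Eqv a b c d) : unit a * unit b = unit c * unit d := by
  ext1
  have h₁ := congrArg (C (R := KRing G)) (KRing.l_mul_l_of_eqv h)
  have h₂ : lX a + lX b = lX c + lX d := by rw [← lX_mul, ← lX_mul, sg3 _ _ _ _ h]
  rw [map_mul, map_mul] at h₁
  simp only [Units.val_mul, val_unit]
  have h₃ : lX a * lX b = lX c * lX d := by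
    simp only [lX]
    linear_combination X ^ 2 * h₁
  linear_combination h₂ + h₃

/-- The total Stiefel-Whitney class `∏ (1 + l(aᵢ) t)` of a form. -/
noncomputable def total (φ : List G) : (PowerSeries (KRing G))ˣ := (φ.map unit).prod

theorem total_append (φ ψ : List G) : total (φ ++ ψ) = total φ * total ψ := by simp [total]

theorem total_chain {φ ψ : List G} (h : Chain φ ψ) : total φ = total ψ := by
  have key : ∀ {φ ψ : List G}, Step φ ψ → total φ = total ψ := by
    intro φ ψ h
    induction h with
    | head l h => simp [total, ← mul_assoc, unit_mul_of_eqv h]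
    | tail a _ ih =>
      simp only [total, List.map_cons, List.prod_cons] at ih ⊢
      rw [ih]
  induction h with
  | refl => rfl
  | tail _ s ih => exact ih.trans (key s)

theorem unit_one : unit (1 : G) = 1 := by
  ext1
  rw [val_unit, lX_one, add_zero, Units.val_one]

theorem total_hyp (m : ℕ) : total (hyp G m) = unit negOne ^ m := by
  induction m with
  | zero => rfl
  | succ m ih =>
    simp only [total, hyp, List.map_cons, List.prod_cons, unit_one, one_mul] at ih ⊢
    rw [ih, pow_succ']

/-- The total Stiefel-Whitney class of a form, normalised to be trivial on hyperbolic forms, as a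
function on the Witt ring. It is a homomorphism on the fundamental ideal. -/
noncomputable def sw : Witt G → (PowerSeries (KRing G))ˣ :=
  Quotient.lift (fun φ : List G => total φ * (unit negOne ^ (φ.length / 2))⁻¹) (by
    intro φ ψ h
    obtain ⟨m, n, h⟩ := wittEquiv_iff.1 h
    have h₁ := total_chain h
    have h₂ := h.length_eq
    simp only [List.length_append, hyp_length] at h₂
    rw [total_append, total_append, total_hyp, total_hyp] at h₁
    -- Adding $m$ hyperbolic planes raises the dimension by $2m$, so the halved dimensions compare
    -- exactly, even when rounded down for odd forms.
    have h₃ : φ.length / 2 + m = ψ.length / 2 + n := by omega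
    change _ * _ = _ * _
    rw [← div_eq_mul_inv, ← div_eq_mul_inv, div_eq_div_iff_mul_eq_mul]
    refine mul_right_cancel (b := unit negOne ^ (m + n)) ?_
    calc _ = total φ * unit negOne ^ m * unit negOne ^ (ψ.length / 2 + n) := by
          rw [pow_add, pow_add]; simp only [mul_assoc, mul_comm, mul_left_comm]
      _ = _ := by
          rw [h₁, ← h₃, pow_add, pow_add]; simp only [mul_assoc, mul_comm, mul_left_comm])

theorem sw_mk (φ : List G) :
    sw (Witt.mk φ) = total φ * (unit negOne ^ (φ.length / 2))⁻¹ := rfl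

theorem sw_zero : sw (0 : Witt G) = 1 := by
  rw [Witt.zero_def, sw_mk]
  simp [total]

theorem sw_add (x : Witt G) {y : Witt G} (hy : y ∈ RingHom.ker (dim2 G)) :
    sw (x + y) = sw x * sw y := by
  obtain ⟨φ, rfl⟩ := Witt.mk_surj x
  obtain ⟨ψ, rfl⟩ := Witt.mk_surj y
  rw [RingHom.mem_ker, dim2_mk] at hy
  obtain ⟨m, hm⟩ := ZMod.natCast_eq_zero_iff_even.1 hy
  -- Rounded halving is additive here because the second dimension is even.
  have h : (φ ++ ψ).length / 2 = φ.length / 2 + ψ.length / 2 := by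
    rw [List.length_append]; omega
  rw [Witt.mk_add, sw_mk, sw_mk, sw_mk, h, total_append, pow_add, mul_inv, mul_mul_mul_comm]

theorem sw_neg {x : Witt G} (hx : x ∈ RingHom.ker (dim2 G)) : sw (-x) = (sw x)⁻¹ := by
  rw [_root_.eq_inv_iff_mul_eq_one, ← sw_add _ hx, neg_add_cancel, sw_zero]

/-- The difference is the form $\langle a,-b\rangle$, and $\langle
b,-b\rangle\equiv\langle1,-1\rangle$ gives $(1+l(b)t)(1+l(-b)t)=1+l(-1)t$, which is the normalising
factor. -/
theorem sw_single_sub (a b : G) : sw (Witt.mk [a] - Witt.mk [b]) * unit b = unit a := by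
  have h : unit negOne = unit b * unit (neg b) := by
    rw [neg, unit_mul_of_eqv (sg2 b), unit_one, one_mul]
  rw [sub_eq_add_neg, ← Witt.mk_neg_single, Witt.mk_add, sw_mk]
  simp [total, h]

/-! ### The Stiefel-Whitney class of a Pfister form -/

/-- The series `E^{2^n-(n+1)} ∏ l(gᵢ) t` with `E = l(-1) t`. -/
noncomputable def series {n : ℕ} (g : Fin (n + 1) → G) : PowerSeries (KRing G) :=
  lX negOne ^ (2 ^ n - (n + 1)) * ∏ i, lX (g i)

/-- Each factor satisfies $(l(g_i)t)^2=E\,l(g_i)t$, so squaring the product yields $E^{n+1}$. This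
completes $E^{2^n-(n+1)}$ to $E^{2^n}$; the subtraction is genuine because $n<2^n$. -/
theorem series_mul_self {n : ℕ} (g : Fin (n + 1) → G) :
    series g * series g = lX negOne ^ (2 ^ n) * series g := by
  have h : (∏ i, lX (g i)) * ∏ i, lX (g i) = lX negOne ^ (n + 1) * ∏ i, lX (g i) := by
    rw [← Finset.prod_mul_distrib]
    simp only [lX_mul_self]
    simp [Finset.prod_mul_distrib]
  have hn : 2 ^ n = (2 ^ n - (n + 1)) + (n + 1) := (Nat.sub_add_cancel Nat.lt_two_pow_self).symm
  rw [series, mul_mul_mul_comm, h]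
  generalize 2 ^ n - (n + 1) = k at hn ⊢
  rw [hn, pow_add]
  ring

/-- By this identity the right side of `sw_mul_pfister` is $1$ plus the series of the Pfister form
extended by $a$, which is what makes its induction close. -/
theorem series_cons {n : ℕ} (a : G) (g : Fin (n + 1) → G) :
    series (Fin.cons a g : Fin (n + 2) → G) =
      lX a * (series g * lX negOne ^ (2 ^ n - 1)) := by
  have hn : 2 ^ (n + 1) - (n + 2) = 2 ^ n - (n + 1) + (2 ^ n - 1) := by
    have := Nat.lt_two_pow_self (n := n)
    rw [pow_succ]
    omega
  rw [series, series, Fin.prod_univ_succ, hn, pow_add]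
  simp only [Fin.cons_zero, Fin.cons_succ]
  ring

theorem series_eq {n : ℕ} (g : Fin (n + 1) → G) :
    series g = C (KRing.l negOne ^ (2 ^ n - (n + 1)) * ∏ i, KRing.l (g i)) * X ^ 2 ^ n := by
  have hn : 2 ^ n = (2 ^ n - (n + 1)) + (n + 1) := (Nat.sub_add_cancel Nat.lt_two_pow_self).symm
  nth_rw 2 [hn]
  simp only [series, lX, Finset.prod_mul_distrib, mul_pow, map_mul, map_pow, map_prod]
  simp [pow_add]
  ring

theorem isUnit_one_add_series {n : ℕ} (g : Fin (n + 1) → G) : IsUnit (1 + series g) := by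
  refine isUnit_one_add ?_
  rw [series_eq]
  exact Dvd.dvd.mul_left (dvd_pow_self _ (by positivity)) _

theorem pfister_mem {n : ℕ} (g : Fin (n + 1) → G) :
    ∏ i, Witt.mk [1, neg (g i)] ∈ RingHom.ker (dim2 G) := by
  rw [Fin.prod_univ_succ]
  exact Ideal.mul_mem_right _ _ (Witt.pfister_mem _)

/-- The Stiefel-Whitney class of a scaled Pfister form. -/
theorem sw_mul_pfister {n : ℕ} (a : G) (g : Fin (n + 1) → G) :
    (sw (Witt.mk [a] * ∏ i, Witt.mk [1, neg (g i)]) : PowerSeries (KRing G)) * (1 + series g) =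
      1 + lX a * (series g * lX negOne ^ (2 ^ n - 1)) := by
  induction n generalizing a with
  | zero =>
    have h := congrArg Units.val (sw_single_sub a (a * g 0))
    rw [Units.val_mul, val_unit, val_unit, lX_mul] at h
    have e : Witt.mk [a] * ∏ i, Witt.mk [1, neg (g i)] = Witt.mk [a] - Witt.mk [a * g 0] := by
      rw [← Witt.mk_mul_single, Fin.prod_univ_one, Witt.mk_pfister, mul_sub, mul_one]
    have hs : series g = lX (g 0) := by simp [series]
    rw [e, hs]
    have hu : IsUnit (1 + (lX a + lX (g 0))) := by
      rw [← lX_mul]; exact (unit (a * g 0)).isUnit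
    -- After multiplication by the unit $1+l(ag_0)t$, the excess $l(a)^2l(g_0)+l(a)l(g_0)^2$, up to
    -- a power of $t$, equals $2\,l(-1)l(a)l(g_0)=0$.
    refine hu.mul_right_cancel ?_
    simp only [pow_zero, Nat.sub_self, mul_one]
    linear_combination (1 + lX (g 0)) * h - lX (g 0) * lX_mul_self a - lX a * lX_mul_self (g 0) -
      lX negOne * lX a * lX (g 0) * two_eq_zero (G := G)
  | succ n ih =>
    obtain ⟨b, f, rfl⟩ : ∃ b f, g = Fin.cons b f := ⟨g 0, Fin.tail g, (Fin.cons_self_tail g).symm⟩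
    -- With $P$ the Pfister form of `f`, this is $\langle a\rangle\langle1,-b\rangle P+\langle
    -- ab\rangle P=\langle a\rangle P$. The term $\langle ab\rangle P$ is why the induction concerns
    -- scaled Pfister forms.
    have e : Witt.mk [a] * ∏ i, Witt.mk [1, neg ((Fin.cons b f : Fin (n + 2) → G) i)] +
        Witt.mk [a * b] * ∏ i, Witt.mk [1, neg (f i)] =
        Witt.mk [a] * ∏ i, Witt.mk [1, neg (f i)] := by
      rw [Fin.prod_univ_succ, ← Witt.mk_mul_single]
      simp only [Fin.cons_zero, Fin.cons_succ, Witt.mk_pfister]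
      ring
    have h := congrArg (fun x => (sw x : PowerSeries (KRing G))) e
    simp only [sw_add _ (Ideal.mul_mem_left _ _ (pfister_mem f)), Units.val_mul] at h
    have h₁ := ih a f
    have h₂ := ih (a * b) f
    have hq := series_mul_self f
    have hy := lX_mul_self a
    have hx := lX_mul_self b
    -- With $m=E^{2^n-1}$, these equalities read $E^{2^n}=mE$ and $E^{2^{n+1}-1}=m^2E$, making the
    -- goal a polynomial identity in $m$ and $E$.
    have hN : (2 : ℕ) ^ n = 2 ^ n - 1 + 1 := (Nat.sub_add_cancel Nat.one_le_two_pow).symm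
    have hN' : 2 ^ (n + 1) - 1 = (2 ^ n - 1) + (2 ^ n - 1) + 1 := by rw [pow_succ]; omega
    rw [lX_mul] at h₂
    rw [hN', pow_succ, pow_add, series_cons]
    rw [hN, pow_succ] at hq
    refine ((sw (Witt.mk [a * b] * ∏ i, Witt.mk [1, neg (f i)])).isUnit.mul
      (isUnit_one_add_series f)).mul_right_cancel ?_
    generalize (sw (Witt.mk [a] * ∏ i, Witt.mk [1, neg ((Fin.cons b f : Fin (n + 2) → G) i)]) :
      PowerSeries (KRing G)) = D at *
    generalize (sw (Witt.mk [a] * ∏ i, Witt.mk [1, neg (f i)]) : PowerSeries (KRing G)) = D₁ at *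
    generalize (sw (Witt.mk [a * b] * ∏ i, Witt.mk [1, neg (f i)]) : PowerSeries (KRing G)) = D₂
      at *
    generalize series f = q at *
    generalize lX (negOne : G) ^ (2 ^ n - 1) = m at *
    generalize lX (negOne : G) = e at *
    generalize lX a = y at *
    generalize lX b = x at *
    -- The hypotheses give $D\,(1+(x+y)qm)=1+yqm$. The claim reduces to
    -- $(1+yqm)(1+xqm)=(1+xyqm^3e)(1+(x+y)qm)$, which follows from $q^2=meq$ and $xy(x+y)=2exy=0$.
    linear_combination h * (1 + x * (q * m)) * (1 + q) + h₁ * (1 + x * (q * m)) -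
      h₂ * (1 + y * ((x * (q * m)) * (m * m * e))) + y * x * m ^ 2 * hq -
      q ^ 2 * m ^ 4 * e * (x * hy + y * hx) -
      q ^ 2 * m ^ 4 * e ^ 2 * y * x * two_eq_zero (G := G)

end StiefelWhitney

end SpecialGroup

namespace SpecialGroup

variable {G : Type u} [SpecialGroup G]

namespace StiefelWhitney

open PowerSeries

/-! ### Leading coefficients of series congruent to $1$ modulo $X^N$ -/

section LeadingCoefficient

variable {R : Type*} [CommRing R] {N : ℕ} {f g : PowerSeries R}

theorem X_pow_dvd_mul_sub_one (hf : X ^ N ∣ f - 1) (hg : X ^ N ∣ g - 1) :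
    X ^ N ∣ f * g - 1 := by
  have e : f * g - 1 = (f - 1) * g + (g - 1) := by ring
  rw [e]
  exact dvd_add (hf.mul_right g) hg

/-- In $fg=(f-1)(g-1)+f+g-1$ the first term is divisible by $X^{2N}$, and $N<2N$. -/
theorem coeff_mul_of_X_pow_dvd (hN : 1 ≤ N) (hf : X ^ N ∣ f - 1) (hg : X ^ N ∣ g - 1) :
    coeff N (f * g) = coeff N f + coeff N g := by
  have h : X ^ (N + N) ∣ (f - 1) * (g - 1) := by
    rw [pow_add]; exact mul_dvd_mul hf hg
  have h₀ := X_pow_dvd_iff.1 h N (by omega)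
  have h₁ : coeff N (1 : PowerSeries R) = 0 := by rw [coeff_one, if_neg (by omega)]
  have e : f * g = (f - 1) * (g - 1) + f + g - 1 := by ring
  rw [e, map_sub, map_add, map_add, h₀, h₁, zero_add, sub_zero]

theorem X_pow_dvd_inv_sub_one {u : (PowerSeries R)ˣ} (hu : X ^ N ∣ (u : PowerSeries R) - 1) :
    X ^ N ∣ ((u⁻¹ : (PowerSeries R)ˣ) : PowerSeries R) - 1 := by
  have e : ((u⁻¹ : (PowerSeries R)ˣ) : PowerSeries R) - 1 =
      -((u⁻¹ : (PowerSeries R)ˣ) : PowerSeries R) * (u - 1) := by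
    linear_combination u.inv_mul
  rw [e]
  exact hu.mul_left _

theorem coeff_inv_of_X_pow_dvd {u : (PowerSeries R)ˣ} (hN : 1 ≤ N)
    (hu : X ^ N ∣ (u : PowerSeries R) - 1) :
    coeff N ((u⁻¹ : (PowerSeries R)ˣ) : PowerSeries R) = -coeff N (u : PowerSeries R) := by
  have h := coeff_mul_of_X_pow_dvd hN (X_pow_dvd_inv_sub_one hu) hu
  rw [u.inv_mul, coeff_one, if_neg (by omega)] at h
  exact eq_neg_of_add_eq_zero_left h.symm

end LeadingCoefficient

/-! ### Stiefel-Whitney classes on powers of the fundamental ideal -/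

theorem sw_pfister {n : ℕ} (g : Fin (n + 1) → G) :
    (sw (∏ i, Witt.mk [1, neg (g i)]) : PowerSeries (KRing G)) * (1 + series g) = 1 := by
  have h := sw_mul_pfister 1 g
  rwa [← Witt.one_def, one_mul, lX_one, zero_mul, add_zero] at h

theorem X_pow_dvd_sw_pfister {n : ℕ} (g : Fin (n + 1) → G) :
    X ^ 2 ^ n ∣ (sw (∏ i, Witt.mk [1, neg (g i)]) : PowerSeries (KRing G)) - 1 := by
  have e : (sw (∏ i, Witt.mk [1, neg (g i)]) : PowerSeries (KRing G)) - 1 =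
      -(sw (∏ i, Witt.mk [1, neg (g i)]) : PowerSeries (KRing G)) * series g := by
    linear_combination sw_pfister g
  rw [e, series_eq]
  exact ((Dvd.intro_left _ rfl).mul_left _)

/-- The class is the inverse of $1+ct^{2^n}$. Its constant term is $1$, so its coefficient in degree
$2^n$ is $-c$, which is $c$ modulo $2$. -/
theorem coeff_sw_pfister {n : ℕ} (g : Fin (n + 1) → G) :
    coeff (2 ^ n) (sw (∏ i, Witt.mk [1, neg (g i)]) : PowerSeries (KRing G)) =
      KRing.l negOne ^ (2 ^ n - (n + 1)) * ∏ i, KRing.l (g i) := by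
  have hN : 2 ^ n ≠ 0 := by positivity
  have h := sw_pfister g
  have h₀ := congrArg constantCoeff h
  have h₁ := congrArg (coeff (2 ^ n)) h
  rw [series_eq, mul_add, mul_one, ← mul_assoc, map_add, coeff_mul_X_pow', if_pos le_rfl,
    coeff_one, if_neg hN, Nat.sub_self, coeff_zero_eq_constantCoeff_apply, map_mul,
    constantCoeff_C] at h₁
  rw [series_eq, map_mul, map_add, map_one, map_mul _ (C _), map_pow, constantCoeff_X,
    zero_pow hN, mul_zero, add_zero, mul_one] at h₀
  rw [h₀, one_mul] at h₁
  rw [eq_neg_of_add_eq_zero_left h₁]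
  exact neg_eq_of_add_eq_zero_left (KRing.add_self _)

/-- On `Iⁿ⁺¹` the Stiefel-Whitney class starts in degree `2ⁿ`. -/
theorem sw_of_mem_pow {n : ℕ} {x : Witt G} (hx : x ∈ RingHom.ker (dim2 G) ^ (n + 1)) :
    X ^ 2 ^ n ∣ (sw x : PowerSeries (KRing G)) - 1 ∧
      coeff (2 ^ n) (sw x : PowerSeries (KRing G)) ∈ KRing.degree G (2 ^ n) := by
  have hN : 1 ≤ 2 ^ n := Nat.one_le_two_pow
  -- Membership in $I$ is carried along because `sw_add` and `sw_neg` need it.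
  suffices h : x ∈ RingHom.ker (dim2 G) ∧ X ^ 2 ^ n ∣ (sw x : PowerSeries (KRing G)) - 1 ∧
      coeff (2 ^ n) (sw x : PowerSeries (KRing G)) ∈ KRing.degree G (2 ^ n) from h.2
  replace hx := pow_ker_le_pfisterSpan hx
  induction hx using AddSubgroup.closure_induction with
  | mem x h =>
    obtain ⟨g, rfl⟩ := h
    refine ⟨pfister_mem g, X_pow_dvd_sw_pfister g, ?_⟩
    rw [coeff_sw_pfister]
    have := SetLike.mul_mem_graded (A := KRing.degree G)
      (KRing.top_mem (G := G) (2 ^ n - (n + 1))) (KRing.prod_l_mem g)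
    rwa [Nat.sub_add_cancel Nat.lt_two_pow_self] at this
  | zero =>
    refine ⟨zero_mem _, ?_, ?_⟩
    · rw [sw_zero, Units.val_one, sub_self]; exact dvd_zero _
    · rw [sw_zero, Units.val_one, coeff_one, if_neg (by omega)]; exact zero_mem _
  | add x y _ _ hx hy =>
    refine ⟨add_mem hx.1 hy.1, ?_, ?_⟩
    · rw [sw_add _ hy.1, Units.val_mul]
      exact X_pow_dvd_mul_sub_one hx.2.1 hy.2.1
    · rw [sw_add _ hy.1, Units.val_mul, coeff_mul_of_X_pow_dvd hN hx.2.1 hy.2.1]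
      exact add_mem hx.2.2 hy.2.2
  | neg x _ hx =>
    refine ⟨neg_mem hx.1, ?_, ?_⟩
    · rw [sw_neg hx.1]
      exact X_pow_dvd_inv_sub_one hx.2.1
    · rw [sw_neg hx.1, coeff_inv_of_X_pow_dvd hN hx.2.1]
      exact neg_mem hx.2.2

variable (G) in
/-- The homomorphism `Iⁿ⁺¹ / Iⁿ⁺² → k_{2ⁿ}(G)` given by the Stiefel-Whitney class of
degree `2ⁿ`. -/
noncomputable def swHom (n : ℕ) :
    Gr.Piece (RingHom.ker (dim2 G)) (n + 1) →+ KRing.degree G (2 ^ n) :=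
  Gr.lift (n + 1) (fun x hx => ⟨coeff (2 ^ n) (sw x : PowerSeries (KRing G)), (sw_of_mem_pow hx).2⟩)
    (fun x y hx hy => Subtype.ext <| by
      change coeff _ (sw (x + y) : PowerSeries (KRing G)) = coeff _ (sw x : PowerSeries (KRing G)) +
        coeff _ (sw y : PowerSeries (KRing G))
      rw [sw_add _ (Ideal.pow_le_self n.succ_ne_zero hy), Units.val_mul]
      exact coeff_mul_of_X_pow_dvd Nat.one_le_two_pow (sw_of_mem_pow hx).1 (sw_of_mem_pow hy).1)
    (fun x _ h => Subtype.ext <| by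
      -- On $I^{n+2}$ the class is $1$ modulo $t^{2^{n+1}}$, so degree $2^n$ lies below its first
      -- nontrivial term.
      have h' := X_pow_dvd_iff.1 (sw_of_mem_pow h).1 (2 ^ n)
        (Nat.pow_lt_pow_right one_lt_two n.lt_succ_self)
      rw [map_sub, coeff_one, if_neg (by positivity), sub_zero] at h'
      exact h')

theorem swHom_pfister {n : ℕ} (g : Fin (n + 1) → G) (h) :
    (swHom G n (Gr.mk _ (n + 1) (∏ i, Witt.mk [1, neg (g i)]) h) : KRing G) =
      KRing.l negOne ^ (2 ^ n - (n + 1)) * ∏ i, KRing.l (g i) :=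
  coeff_sw_pfister g

end StiefelWhitney

/-! ### The map from K-theory to the graded Witt ring -/

theorem prod_pfister_mem {n : ℕ} (g : Fin n → G) :
    ∏ i, Witt.mk [1, neg (g i)] ∈ RingHom.ker (dim2 G) ^ n := SG.pfister_mem ⟨G⟩ g

namespace KRing

/-- Here $\langle1,-a\rangle\equiv\langle b,-ab\rangle=\langle b\rangle\langle1,-a\rangle$, so
$1-\langle b\rangle$ annihilates $\langle1,-a\rangle$. -/
theorem mk_mul_of_represents {a b : G} (h : Represents [1, neg a] b) :
    Witt.mk [1, neg a] * Witt.mk [1, neg b] = 0 := by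
  have e : Witt.mk [1, neg a] = Witt.mk [b] * Witt.mk [1, neg a] := by
    refine (Witt.mk_eq (Chain.head [] (represents_pair h)).witt).trans ?_
    rw [Witt.mk_mul]
    simp [tensor]
  rw [Witt.mk_pfister b, mul_sub, mul_one, mul_comm, ← e, sub_self]

variable (G) in
/-- `l(a) ↦ ⟨1,-a⟩ + I²` in the graded Witt ring. -/
noncomputable def toGradGen : Additive G →+ DirectSum ℕ (Gr.Piece (RingHom.ker (dim2 G))) :=
  AddMonoidHom.mk' (fun a => DirectSum.of _ 1 (Gr.mk _ 1 (Witt.mk [1, neg a.toMul])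
    (by rw [pow_one]; exact Witt.pfister_mem _))) fun a b => by
    rw [← map_add, Gr.mk_add]
    congr 1
    rw [Gr.mk_eq_mk]
    -- The failure of additivity in $W(G)$ is a product of two elements of $I$.
    have e : Witt.mk [1, neg (a + b).toMul] -
        (Witt.mk [1, neg a.toMul] + Witt.mk [1, neg b.toMul]) =
        -(Witt.mk [1, neg a.toMul] * Witt.mk [1, neg b.toMul]) := by
      simp only [Witt.mk_pfister, toMul_add, ← Witt.mk_mul_single]
      ring
    rw [e, pow_succ, pow_one]
    exact neg_mem (Ideal.mul_mem_mul (Witt.pfister_mem _) (Witt.pfister_mem _))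

variable (G) in
/-- The ring homomorphism from `k_*(G)` to the graded Witt ring. -/
noncomputable def toGrad : KRing G →+* DirectSum ℕ (Gr.Piece (RingHom.ker (dim2 G))) :=
  lift (toGradGen G)
    (fun a b h => by
      refine (Gr.of_mk_mul_of_mk _ _).trans ?_
      rw [Gr.mk_eq_zero, map_zero]
      have e := mk_mul_of_represents h
      simp only [toMul_ofMul, e, zero_mem])
    (by
      have e : (2 : DirectSum ℕ (Gr.Piece (RingHom.ker (dim2 G)))) =
          DirectSum.of (Gr.Piece (RingHom.ker (dim2 G))) 0 (Gr.mk _ 0 1 Gr.one_mem) +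
          DirectSum.of (Gr.Piece (RingHom.ker (dim2 G))) 0 (Gr.mk _ 0 1 Gr.one_mem) :=
        one_add_one_eq_two.symm
      rw [e, ← map_add]
      exact (congrArg _ ((Gr.igr (dim2 G)).add_self_eq 0 (Gr.mk _ 0 1 Gr.one_mem))).trans
        (map_zero _))

theorem toGrad_l (a : G) : toGrad G (l a) =
    DirectSum.of _ 1 (Gr.mk _ 1 (Witt.mk [1, neg a])
      (by rw [pow_one]; exact Witt.pfister_mem _)) := lift_l _ _ _ a

theorem toGrad_prod {n : ℕ} (g : Fin n → G) :
    toGrad G (∏ i, l (g i)) =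
      DirectSum.of _ n (Gr.mk _ n (∏ i, Witt.mk [1, neg (g i)]) (prod_pfister_mem g)) := by
  induction n with
  | zero =>
    rw [Fin.prod_univ_zero, map_one]
    exact congrArg (DirectSum.of _ 0) (Gr.mk_congr (by simp))
  | succ n ih =>
    rw [Fin.prod_univ_succ, map_mul, ih, toGrad_l]
    refine (Gr.of_mk_mul_of_mk _ _).trans ?_
    refine DirectSum.of_eq_of_gradedMonoid_eq (Gr.graded_mk_eq _ _ (add_comm 1 n) ?_)
    rw [Fin.prod_univ_succ]

variable (G) in
/-- The component `k_n(G) → Iⁿ / Iⁿ⁺¹`. -/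
noncomputable def toGradHom (n : ℕ) : degree G n →+ Gr.Piece (RingHom.ker (dim2 G)) n :=
  (DirectSum.component ℤ ℕ (fun i => Gr.Piece (RingHom.ker (dim2 G)) i) n).toAddMonoidHom.comp
    ((toGrad G).toAddMonoidHom.comp (degree G n).subtype.toAddMonoidHom)

theorem toGradHom_prod {n : ℕ} (g : Fin n → G) :
    toGradHom G n ⟨∏ i, l (g i), prod_l_mem g⟩ =
      Gr.mk _ n (∏ i, Witt.mk [1, neg (g i)]) (prod_pfister_mem g) := by
  change (toGrad G (∏ i, l (g i))) n = _
  rw [toGrad_prod, DirectSum.of_eq_same]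

/-- The ring map is homogeneous, as seen on symbols, so taking the component of degree $n$ loses
nothing. -/
theorem of_toGradHom {n : ℕ} (x : degree G n) :
    DirectSum.of _ n (toGradHom G n x) = toGrad G (x : KRing G) := by
  have h : (DirectSum.of (Gr.Piece (RingHom.ker (dim2 G))) n).comp (toGradHom G n) =
      (toGrad G).toAddMonoidHom.comp (degree G n).subtype.toAddMonoidHom :=
    degree_hom_ext fun g => by
      simp only [AddMonoidHom.comp_apply, toGradHom_prod]
      exact (toGrad_prod g).symm
  exact DFunLike.congr_fun h x

theorem toGradHom_surjective (n : ℕ) : Function.Surjective (toGradHom G n) := by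
  intro y
  obtain ⟨x, hx, rfl⟩ := Gr.mk_surj y
  cases n with
  | zero =>
    have h := toGradHom_prod (Fin.elim0 : Fin 0 → G)
    -- In degree $0$ Pfister generation is replaced by $W/I\cong\mathbb F_2$: every class is that of
    -- $0$ or $1$.
    rcases (by decide : ∀ z : ZMod 2, z = 0 ∨ z = 1) (dim2 G x) with h' | h'
    · refine ⟨0, (map_zero _).trans (Gr.mk_eq_zero ?_).symm⟩
      rwa [zero_add, pow_one, RingHom.mem_ker]
    · refine ⟨_, h.trans (Gr.mk_eq_mk.2 ?_)⟩
      rw [zero_add, pow_one, RingHom.mem_ker, map_sub, h', Fin.prod_univ_zero, map_one, sub_self]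
  | succ n =>
    suffices h : ∃ z, toGradHom G (n + 1) z = Gr.mk _ (n + 1) x hx from h
    have hp := pow_ker_le_pfisterSpan hx
    have hle : ∀ y ∈ pfisterSpan G (n + 1), y ∈ RingHom.ker (dim2 G) ^ (n + 1) := by
      intro y hy
      induction hy using AddSubgroup.closure_induction with
      | mem y h => obtain ⟨g, rfl⟩ := h; exact prod_pfister_mem g
      | zero => exact zero_mem _
      | add y z _ _ hy hz => exact add_mem hy hz
      | neg y _ hy => exact neg_mem hy
    induction hp using AddSubgroup.closure_induction with
    | mem x h => obtain ⟨g, rfl⟩ := h; exact ⟨_, toGradHom_prod g⟩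
    | zero => exact ⟨0, map_zero _⟩
    | add x y hx' hy' ihx ihy =>
      obtain ⟨z, hz⟩ := ihx (hle x hx')
      obtain ⟨w, hw⟩ := ihy (hle y hy')
      exact ⟨z + w, by rw [map_add, hz, hw]; rfl⟩
    | neg x hx' ihx =>
      obtain ⟨z, hz⟩ := ihx (hle x hx')
      exact ⟨-z, by rw [map_neg, hz]; rfl⟩

end KRing

end SpecialGroup

open CategoryTheory SpecialGroup

theorem Igr.of_injective (R : Igr.{u}) (n : ℕ) : Function.Injective (R.of n) :=
  DirectSum.of_injective n

/-- A morphism that is bijective in every degree is an isomorphism. -/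
theorem Igr.isIso_of_bijective {R S : Igr.{u}} (f : R ⟶ S)
    (h : ∀ n, Function.Bijective (Igr.map f n)) : IsIso f := by
  let e : ∀ n, R.R n ≃+ S.R n := fun n => AddEquiv.ofBijective (Igr.map f n) (h n)
  have he : ∀ n x, (e n).symm (Igr.map f n x) = x := fun n x => (e n).symm_apply_apply x
  have he' : ∀ n x, Igr.map f n ((e n).symm x) = x := fun n x => (e n).apply_symm_apply x
  refine ⟨(⟨fun n => (e n).symm.toAddMonoidHom, fun n => ?_, fun n m x y => ?_⟩ : Igr.Hom S R),
    ?_, ?_⟩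
  · exact (congrArg (e n).symm (f.map_top n)).symm.trans (he n _)
  -- Multiplicativity of the inverse is tested after applying the injective map `f`.
  · refine (h (n + m)).1 ((he' _ _).trans ((Igr.Hom.map_mul f n m _ _).trans ?_).symm)
    exact congrArg₂ GradedMonoid.GMul.mul (he' n x) (he' m y)
  · exact Igr.Hom.ext (funext fun n => AddMonoidHom.ext fun x => he n x)
  · exact Igr.Hom.ext (funext fun n => AddMonoidHom.ext fun x => he' n x)

namespace SG

/-! ### Computing in the total ring of $k(G)$ -/

theorem of_mul_of (G : SG.{u}) {n m : ℕ} (x : KRing.degree G n) (y : KRing.degree G m) :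
    (k.obj G).of n x * (k.obj G).of m y =
      (k.obj G).of (n + m) (⟨x.1 * y.1, SetLike.mul_mem_graded x.2 y.2⟩ : KRing.degree G (n + m)) :=
  DirectSum.of_mul_of _ _

/-- Homogeneous elements whose degrees are only propositionally equal are compared inside the total
ring, which avoids transports. -/
theorem of_eq_of {G : SG.{u}} {n m : ℕ} {x : KRing.degree G n} {y : KRing.degree G m}
    (h : n = m) (h' : (x : KRing G) = y) : (k.obj G).of n x = (k.obj G).of m y := by
  subst h
  rw [Subtype.ext h']

theorem of_l_negOne_pow (G : SG.{u}) (m : ℕ) :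
    (k.obj G).of 1 (G.l negOne) ^ m =
      (k.obj G).of m (⟨KRing.l negOne ^ m, KRing.top_mem m⟩ : KRing.degree G m) := by
  induction m with
  | zero =>
    rw [pow_zero]
    exact (k.obj G).top_zero.symm
  | succ m ih =>
    rw [pow_succ', ih]
    exact (of_mul_of G _ _).trans (of_eq_of (add_comm 1 m) (pow_succ' _ _).symm)

theorem of_l_negOne_pow_mul (G : SG.{u}) (m : ℕ) {n : ℕ} (x : KRing.degree G n) :
    (k.obj G).of 1 (G.l negOne) ^ m * (k.obj G).of n x =
      (k.obj G).of (m + n) (⟨KRing.l negOne ^ m * x.1,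
        SetLike.mul_mem_graded (KRing.top_mem m) x.2⟩ : KRing.degree G (m + n)) := by
  rw [of_l_negOne_pow]
  exact of_mul_of G _ _

/-! ### The natural transformation $s$ -/

/-- The natural transformation `s : k → Grad ∘ W`. -/
noncomputable def sHom (G : SG.{u}) : k.obj G ⟶ gradW.obj G :=
  (⟨fun n => KRing.toGradHom G n,
    fun n => by
      refine DirectSum.of_injective (β := Gr.Piece (RingHom.ker (dim2 G))) n ?_
      have h := KRing.toGrad_prod (fun _ : Fin n => (negOne : G))
      -- The distinguished element $l(-1)^n$ goes to $2^n$ because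
      -- $\langle1,-(-1)\rangle=\langle1,1\rangle=2$.
      have e : Witt.mk [1, neg (negOne : G)] = 2 := by
        rw [neg, mul_self_eq, ← one_add_one_eq_two]
        rfl
      simp only [Finset.prod_const, Finset.card_univ, Fintype.card_fin, e] at h
      exact (KRing.of_toGradHom _).trans h,
    fun n m x y => by
      refine DirectSum.of_injective (β := Gr.Piece (RingHom.ker (dim2 G))) (n + m) ?_
      refine (KRing.of_toGradHom _).trans ?_
      refine (map_mul (KRing.toGrad G) _ _).trans ?_
      refine (congrArg₂ (· * ·) (KRing.of_toGradHom x) (KRing.of_toGradHom y)).symm.trans ?_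
      exact DirectSum.of_mul_of _ _⟩ : Igr.Hom (KRing.igr G) (Gr.igr (dim2 G)))

theorem sHom_symbol (G : SG.{u}) {n : ℕ} (g : Fin n → G) :
    Igr.map (sHom G) n (G.symbol g) = G.pfister g := KRing.toGradHom_prod g

theorem k_map_symbol {G H : SG.{u}} (f : G ⟶ H) {n : ℕ} (g : Fin n → G) :
    Igr.map (k.map f) n (G.symbol g) = H.symbol fun i => f.toHom (g i) := by
  have h : KRing.map f (∏ i, KRing.l (g i)) = ∏ i, KRing.l (f.toHom (g i)) := by
    simp only [map_prod, KRing.map_l]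
  exact Subtype.ext h

theorem gradW_map_pfister {G H : SG.{u}} (f : G ⟶ H) {n : ℕ} (g : Fin n → G) :
    Igr.map (gradW.map f) n (G.pfister g) = H.pfister fun i => f.toHom (g i) := by
  have h : Witt.map f (∏ i, Witt.mk [1, neg (g i)]) = ∏ i, Witt.mk [1, neg (f.toHom (g i))] := by
    simp only [map_prod, Witt.map_mk, List.map_cons, List.map_nil, map_one, Hom.map_neg]
  exact Gr.mk_congr h

theorem k_hom_ext {G : SG.{u}} {B : Type*} [AddCommGroup B] {n : ℕ} {p q : (k.obj G).R n →+ B}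
    (h : ∀ g : Fin n → G, p (G.symbol g) = q (G.symbol g)) : p = q :=
  KRing.degree_hom_ext h

theorem sHom_surjective (G : SG.{u}) (n : ℕ) : Function.Surjective (Igr.map (sHom G) n) :=
  KRing.toGradHom_surjective n

/-- Symbols generate $k_n(G)$ and $s_n$ maps it onto $I^n/I^{n+1}$, so Pfister classes generate the
latter, including for $n=0$. -/
theorem gradW_hom_ext {G : SG.{u}} {B : Type*} [AddCommGroup B] {n : ℕ}
    {p q : (gradW.obj G).R n →+ B} (h : ∀ g : Fin n → G, p (G.pfister g) = q (G.pfister g)) :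
    p = q := by
  have e : p.comp (Igr.map (sHom G) n) = q.comp (Igr.map (sHom G) n) := k_hom_ext fun g => by
    simpa only [AddMonoidHom.comp_apply, sHom_symbol] using h g
  ext y
  obtain ⟨x, rfl⟩ := sHom_surjective G n y
  exact DFunLike.congr_fun e x

noncomputable def sNat : k.{u} ⟶ gradW.{u} where
  app := sHom
  naturality G H f := Igr.Hom.ext <| funext fun n => k_hom_ext fun g => by
    change Igr.map (sHom H) n (Igr.map (k.map f) n (G.symbol g)) =
      Igr.map (gradW.map f) n (Igr.map (sHom G) n (G.symbol g))
    rw [k_map_symbol, sHom_symbol, sHom_symbol, gradW_map_pfister]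

/-! ### The natural homomorphisms $r_n$ -/

/-- The homomorphism `r_n : Iⁿ / Iⁿ⁺¹ → k_{2ⁿ⁻¹}`. -/
noncomputable def rHom (G : SG.{u}) :
    ∀ n : ℕ, 1 ≤ n → ((gradW.obj G).R n →+ (k.obj G).R (2 ^ (n - 1)))
  | n + 1, _ => StiefelWhitney.swHom G n

theorem of_rHom_pfister (G : SG.{u}) {n : ℕ} (hn : 1 ≤ n) (g : Fin n → G) :
    (k.obj G).of (2 ^ (n - 1)) (rHom G n hn (G.pfister g)) =
      (k.obj G).of 1 (G.l negOne) ^ (2 ^ (n - 1) - n) * (k.obj G).of n (G.symbol g) := by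
  obtain ⟨n, rfl⟩ := Nat.exists_eq_succ_of_ne_zero (Nat.one_le_iff_ne_zero.1 hn)
  refine Eq.trans ?_ (of_l_negOne_pow_mul G _ _).symm
  exact of_eq_of (Nat.sub_add_cancel Nat.lt_two_pow_self).symm
    (StiefelWhitney.swHom_pfister g (prod_pfister_mem g))

/-- `r_n : Iⁿ / Iⁿ⁺¹ → k_{2ⁿ⁻¹}` as a natural transformation. -/
noncomputable def rNat (n : ℕ) (hn : 1 ≤ n) :
    gradW.{u} ⋙ Igr.component n ⟶ k.{u} ⋙ Igr.component (2 ^ (n - 1)) where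
  app G := AddCommGrpCat.ofHom (rHom G n hn)
  naturality G H f := by
    refine AddCommGrpCat.hom_ext (gradW_hom_ext (G := G) fun g => ?_)
    change rHom H n hn (Igr.map (gradW.map f) n (G.pfister g)) =
      Igr.map (k.map f) _ (rHom G n hn (G.pfister g))
    rw [gradW_map_pfister]
    obtain ⟨n, rfl⟩ := Nat.exists_eq_succ_of_ne_zero (Nat.one_le_iff_ne_zero.1 hn)
    refine Subtype.ext ((StiefelWhitney.swHom_pfister _ (prod_pfister_mem _)).trans ?_)
    refine Eq.trans ?_ (congrArg (KRing.map f)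
      (StiefelWhitney.swHom_pfister g (prod_pfister_mem g))).symm
    simp only [map_mul, map_pow, map_prod, KRing.map_l, f.map_negOne]

/-! ### The composite $r_n\circ s_n$ and injectivity of $s_n$ -/

theorem of_rHom_sHom (G : SG.{u}) {n : ℕ} (hn : 1 ≤ n) (x : (k.obj G).R n) :
    (k.obj G).of (2 ^ (n - 1)) (rHom G n hn (Igr.map (sHom G) n x)) =
      (k.obj G).of 1 (G.l negOne) ^ (2 ^ (n - 1) - n) * (k.obj G).of n x := by
  have h : (DirectSum.of (k.obj G).R (2 ^ (n - 1))).comp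
        ((rHom G n hn).comp (Igr.map (sHom G) n)) =
      (AddMonoidHom.mulLeft ((k.obj G).of 1 (G.l negOne) ^ (2 ^ (n - 1) - n))).comp
        (DirectSum.of (k.obj G).R n) :=
    k_hom_ext fun g => by
      simp only [AddMonoidHom.comp_apply, sHom_symbol]
      exact of_rHom_pfister G hn g
  exact DFunLike.congr_fun h x

/-- `s_n` is injective if multiplication by the power of `l(-1)` is. -/
theorem sHom_injective (G : SG.{u}) {n : ℕ} (hn : 1 ≤ n)
    (h : ∀ x : (k.obj G).R n,
      (k.obj G).of 1 (G.l negOne) ^ (2 ^ (n - 1) - n) * (k.obj G).of n x = 0 → x = 0) :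
    Function.Injective (Igr.map (sHom G) n) := by
  rw [injective_iff_map_eq_zero]
  intro x hx
  refine h x ?_
  rw [← of_rHom_sHom G hn, hx, map_zero]
  exact map_zero _

/-- Write $l(-1)^{m+1}x=l(-1)^m\,(l(-1)x)$. The induction on $m$ applies to $l(-1)x$ in degree
$1+n$, and [SMC] in degree $n$ then removes the last factor. -/
theorem IsSMC.eq_zero_of_mul {G : SG.{u}} (h : G.IsSMC) (m : ℕ) {n : ℕ} (hn : 1 ≤ n)
    {x : (k.obj G).R n} (hx : (k.obj G).of 1 (G.l negOne) ^ m * (k.obj G).of n x = 0) :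
    x = 0 := by
  induction m generalizing n with
  | zero =>
    rw [pow_zero, one_mul] at hx
    exact (k.obj G).of_injective n (hx.trans (map_zero _).symm)
  | succ m ih =>
    rw [pow_succ, mul_assoc] at hx
    refine h.2 n hn ((ih (Nat.le_add_right 1 n)
      ((congrArg (_ * ·) (DirectSum.of_mul_of _ _)).symm.trans hx)).trans ?_)
    exact (DirectSum.GNonUnitalNonAssocSemiring.mul_zero (A := (k.obj G).R) (G.l negOne)).symm

/-- Both sides have two elements, so surjectivity suffices. -/
theorem sHom_zero_bijective (G : SG.{u}) : Function.Bijective (Igr.map (sHom G) 0) := by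
  obtain ⟨e⟩ := (k.obj G).zero_equiv
  obtain ⟨e'⟩ := (gradW.obj G).zero_equiv
  have : Finite ((k.obj G).R 0) := Finite.of_equiv _ e.symm.toEquiv
  exact (sHom_surjective G 0).bijective_of_nat_card_le
    (Nat.card_congr (e.trans e'.symm).toEquiv).le

end SG

/-! ### The main theorem -/

theorem mainTheorem7 :
    ∃ (s : SG.k.{u} ⟶ SG.gradW.{u})
      (r : ∀ n : ℕ, 1 ≤ n →
        (SG.gradW.{u} ⋙ Igr.component n ⟶ SG.k.{u} ⋙ Igr.component (2 ^ (n - 1)))),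
      -- the values of `s` and `r` on generators
      (∀ (G : SG.{u}) (n : ℕ), 1 ≤ n → ∀ g : Fin n → G,
        Igr.map (s.app G) n (G.symbol g) = G.pfister g) ∧
      (∀ (G : SG.{u}) (n : ℕ) (hn : 1 ≤ n) (g : Fin n → G),
        (SG.k.obj G).of (2 ^ (n - 1)) (((r n hn).app G).hom (G.pfister g)) =
          (SG.k.obj G).of 1 (G.l SpecialGroup.negOne) ^ (2 ^ (n - 1) - n) *
            (SG.k.obj G).of n (G.symbol g)) ∧
      -- `s` is surjective in every degree
      (∀ (G : SG.{u}) (n : ℕ), Function.Surjective (Igr.map (s.app G) n)) ∧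
      -- `r_n ∘ s_n` is multiplication by a power of `l(-1)`
      (∀ (G : SG.{u}) (n : ℕ) (hn : 1 ≤ n) (x : (SG.k.obj G).R n),
        (SG.k.obj G).of (2 ^ (n - 1)) (((r n hn).app G).hom (Igr.map (s.app G) n x)) =
          (SG.k.obj G).of 1 (G.l SpecialGroup.negOne) ^ (2 ^ (n - 1) - n) *
            (SG.k.obj G).of n x) ∧
      -- `s_1` and `s_2` are isomorphisms
      (∀ G : SG.{u}, Function.Bijective (Igr.map (s.app G) 1)) ∧
      (∀ G : SG.{u}, Function.Bijective (Igr.map (s.app G) 2)) ∧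
      -- if `G` is [SMC], then `s_G` is an isomorphism of inductive graded rings
      (∀ G : SG.{u}, G.IsSMC → IsIso (s.app G)) := by
  -- When the exponent of $l(-1)$ is $0$, as for $n=1$ and $n=2$, the map $r_n$ is a left inverse of
  -- $s_n$. The natural subtraction never truncates, since $n\le2^{n-1}$ for $n\ge1$.
  have inj : ∀ (G : SG.{u}) (n : ℕ), 1 ≤ n → 2 ^ (n - 1) - n = 0 →
      Function.Injective (Igr.map (SG.sHom G) n) := by
    intro G n hn h
    refine SG.sHom_injective G hn fun x hx => ?_
    rw [h, pow_zero, one_mul] at hx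
    exact (SG.k.obj G).of_injective n (hx.trans (map_zero _).symm)
  refine ⟨SG.sNat, SG.rNat, fun G n _ g => SG.sHom_symbol G g,
    fun G n hn g => SG.of_rHom_pfister G hn g, fun G n => SG.sHom_surjective G n,
    fun G n hn x => SG.of_rHom_sHom G hn x,
    fun G => ⟨inj G 1 le_rfl rfl, SG.sHom_surjective G 1⟩,
    fun G => ⟨inj G 2 one_le_two rfl, SG.sHom_surjective G 2⟩, fun G h => ?_⟩
  refine Igr.isIso_of_bijective _ fun n => ?_
  rcases Nat.eq_zero_or_pos n with rfl | hn
  · exact SG.sHom_zero_bijective G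
  · exact ⟨SG.sHom_injective G hn fun x => h.eq_zero_of_mul _ hn, SG.sHom_surjective G n⟩
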